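/- Let $n>2$ and let $v_1,\dots,v_n\in\mathbb{R}^2$ be vectors of equal length with $\det(v_i,v_j)>0$ for all $i<j$. Let $X(w_0)$ be Elnitsky's polygon of the longest element $w_0=n(n-1)\cdots 21$ of the symmetric group $\mathfrak{S}_n$: the equilateral, convex, centrally symmetric $2n$-gon which, from its starting ("top") vertex, has the side vectors $v_1,\dots,v_n,-v_1,\dots,-v_n$ in counterclockwise order. (Every equilateral convex centrally symmetric $2n$-gon arises in this way.) Let $T(w_0)$ be the set of rhombic tilings of $X(w_0)$, that is, of the finite families of rhombi whose edges are congruent and parallel to sides of $X(w_0)$, which have pairwise disjoint interiors and union $X(w_0)$, and in which any two tile edges that meet in more than one point coincide. A tile of $T\in T(w_0)$ is a (strong) perimeter tile if it shares a path of at least two edges with the boundary of $X(w_0)$; let $\mathrm{perim}(T)$ be the number of perimeter tiles of $T$. Then $$\min\{\mathrm{perim}(T) : T\in T(w_0)\}=3 .$$ In other words, every rhombic tiling of $X(w_0)$ has at least three perimeter tiles, and some tiling has exactly three. -/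

import Mathlib

/-- The Euclidean plane. -/
abbrev Plane : Type := EuclideanSpace ℝ (Fin 2)

/-- The cross product (signed area) of two plane vectors. -/
def cross (u v : Plane) : ℝ := u 0 * v 1 - u 1 * v 0

/-- The longest element `n (n-1) ⋯ 2 1` of the symmetric group. The labels `1, …, n` are
the elements of `Fin n`, in order. -/
def longestElement (n : ℕ) : Equiv.Perm (Fin n) := Fin.revPerm

/-- The choices that have to be made to draw Elnitsky polygons for permutations of `n` labels:
a top vertex, and for each label the side vector with that label, read along the leftside boundary
from the top to the bottom. The side vectors all have the same length and turn
counterclockwise by less than a half-turn in total, so that the leftside boundary is half of a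
convex (centrally symmetric) `2n`-gon, and sides with different labels are not parallel.
The drawing may be rotated in the plane: "top" is just the name of the starting vertex. -/
structure ElnitskyDrawing (n : ℕ) where
  top : Plane
  side : Fin n → Plane
  equilateral : ∀ i j, ‖side i‖ = ‖side j‖
  convex : ∀ i j, i < j → 0 < cross (side i) (side j)

/-- A rhombus with edge labels `i < j`, placed by its top vertex. Each rhombus whose edges are
congruent and parallel to sides of the polygon has exactly one such description. -/
structure RhombusTile (n : ℕ) where
  vertex : Plane
  i : Fin n
  j : Fin n
  lt : i < j

namespace ElnitskyDrawing

variable {n : ℕ}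

/-- The vertex that is `k` edges away from the top along the leftside boundary, whose sides are
labelled `1, 2, …, n` from the top. -/
noncomputable def leftVertex (P : ElnitskyDrawing n) (k : ℕ) : Plane :=
  P.top + ∑ i : Fin n with i.val < k, P.side i

/-- The vertex that is `k` edges away from the top along the rightside boundary of the polygon
of `w`, whose sides are labelled `w(1), w(2), …, w(n)` from the top. -/
noncomputable def rightVertex (P : ElnitskyDrawing n) (w : Equiv.Perm (Fin n)) (k : ℕ) : Plane :=
  P.top + ∑ m : Fin n with m.val < k, P.side (w m)

/-- The boundary curve of Elnitsky's polygon of `w`: the union of its `2n` sides. -/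
def boundary (P : ElnitskyDrawing n) (w : Equiv.Perm (Fin n)) : Set Plane :=
  (⋃ k : Fin n, segment ℝ (P.leftVertex k) (P.leftVertex (k + 1))) ∪
    ⋃ k : Fin n, segment ℝ (P.rightVertex w k) (P.rightVertex w (k + 1))

/-- The boundary curve of Elnitsky's polygon of the longest element. -/
def longestBoundary (P : ElnitskyDrawing n) : Set Plane := P.boundary (longestElement n)

/-- The region enclosed by Elnitsky's polygon of the longest element. This polygon is a convex
`2n`-gon (its side vectors, counterclockwise from the top, are `v₁, …, vₙ, -v₁, …, -vₙ`), so
the region is the convex hull of its boundary curve. -/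
def longestRegion (P : ElnitskyDrawing n) : Set Plane := convexHull ℝ P.longestBoundary

/-- The (closed, solid) rhombus of the plane that a tile describes. -/
def carrier (P : ElnitskyDrawing n) (t : RhombusTile n) : Set Plane :=
  {x | ∃ a ∈ Set.Icc (0 : ℝ) 1, ∃ b ∈ Set.Icc (0 : ℝ) 1,
    x = t.vertex + a • P.side t.i + b • P.side t.j}

/-- The four corners of a tile, in cyclic order. -/
def corner (P : ElnitskyDrawing n) (t : RhombusTile n) : Fin 4 → Plane :=
  ![t.vertex, t.vertex + P.side t.i, t.vertex + P.side t.i + P.side t.j, t.vertex + P.side t.j]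

/-- The four edges of a tile, in cyclic order (addition in `Fin 4` is modulo `4`). -/
def edge (P : ElnitskyDrawing n) (t : RhombusTile n) (k : Fin 4) : Set Plane :=
  segment ℝ (P.corner t k) (P.corner t (k + 1))

/-- `T` is a rhombic tiling of Elnitsky's polygon of the longest element: the tiles cover exactly
the region, they do not overlap, and tile edges that meet in more than one point coincide. -/
structure IsRhombicTiling (P : ElnitskyDrawing n) (T : Finset (RhombusTile n)) : Prop where
  cover : (⋃ t ∈ T, P.carrier t) = P.longestRegion
  disjoint : ∀ s ∈ T, ∀ t ∈ T, s ≠ t → Disjoint (interior (P.carrier s)) (interior (P.carrier t))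
  discrete : ∀ s ∈ T, ∀ t ∈ T, ∀ k l : Fin 4,
    (P.edge s k ∩ P.edge t l).Nontrivial → P.edge s k = P.edge t l

/-- A (strong) perimeter tile shares a path of at least two edges with the boundary of the
polygon: two consecutive edges of the tile lie in the boundary. -/
def IsPerimeterTile (P : ElnitskyDrawing n) (t : RhombusTile n) : Prop :=
  ∃ k : Fin 4, P.edge t k ⊆ P.longestBoundary ∧ P.edge t (k + 1) ⊆ P.longestBoundary

open Classical in
/-- The number of (strong) perimeter tiles of a tiling. -/
noncomputable def perim (P : ElnitskyDrawing n) (T : Finset (RhombusTile n)) : ℕ :=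
  (T.filter fun t => P.IsPerimeterTile t).card

end ElnitskyDrawing

/-! Lower bound. Number the sides counterclockwise with period `2 * n`, so that `dir (k + n) = -dir
k`. Side `e` is an edge of some tile (`IsRhombicTiling.exists_isFlag`); let `m e`, with `e < m e < e
+ n`, be the direction number of the other edges of that tile. If sides `e` and `e + 1` lie on
different tiles, the angles of these tiles at the common vertex do not overlap, so `m (e + 1) ≤ m e`
(`IsFlag.le_of_disjoint`). If both lie on one tile, `m` grows by at most `n - 1`. Once around the
polygon `m` grows by `2 * n > 2 * (n - 1)`, so at least three vertices have both adjacent sides on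
one tile, and these tiles are distinct (`modEq_of_corners`).

Attainment. The polygon is the image of the cube `[0, 1]ⁿ` under `zpt` (`longestRegion_eq`). In each
fibre take the point with the least coefficient sum. The side vectors lie on a circle, so for `i < l
< j` one has `D • v_l = α • v_i + β • v_j` with positive factors and `D < α + β`; trading outer
vectors for the middle one lowers the sum. Hence the minimisers are unique and are exactly the
points of the faces `cubeFace i j` (`exists_mem_cubeFace`, `sum_le_of_mem_cubeFace`), whose images
form a tiling. Coefficients on the boundary are monotone in the label
(`coeff_of_mem_longestBoundary`), which leaves three perimeter tiles: the first two labels, the last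
two, and the first with the last. -/

/-! ### Cross products and parallelograms. -/

theorem cross_add_left (u v w : Plane) : cross (u + v) w = cross u w + cross v w := by
  simp [cross]; ring

theorem cross_add_right (u v w : Plane) : cross u (v + w) = cross u v + cross u w := by
  simp [cross]; ring

theorem cross_sub_right (u v w : Plane) : cross u (v - w) = cross u v - cross u w := by
  simp [cross]; ring

theorem cross_smul_left (a : ℝ) (u v : Plane) : cross (a • u) v = a * cross u v := by
  simp [cross]; ring

theorem cross_smul_right (a : ℝ) (u v : Plane) : cross u (a • v) = a * cross u v := by
  simp [cross]; ring

theorem cross_neg_left (u v : Plane) : cross (-u) v = -cross u v := by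
  simp [cross]; ring

theorem cross_neg_right (u v : Plane) : cross u (-v) = -cross u v := by
  simp [cross]; ring

theorem cross_same (u : Plane) : cross u u = 0 := by
  simp [cross]; ring

theorem cross_zero_right (u : Plane) : cross u 0 = 0 := by
  simp [cross]

theorem cross_zero_left (u : Plane) : cross 0 u = 0 := by
  simp [cross]

theorem cross_swap (u v : Plane) : cross u v = -cross v u := by
  simp [cross]; ring

theorem cross_sum_left {ι : Type*} (s : Finset ι) (f : ι → Plane) (v : Plane) :
    cross (∑ i ∈ s, f i) v = ∑ i ∈ s, cross (f i) v := by
  classical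
  induction s using Finset.induction_on with
  | empty => simp [cross_zero_left]
  | insert a s ha ih => rw [Finset.sum_insert ha, Finset.sum_insert ha, cross_add_left, ih]

theorem continuous_cross_left (v : Plane) : Continuous fun u : Plane => cross u v := by
  unfold cross; fun_prop

theorem continuous_cross_right (u : Plane) : Continuous fun v : Plane => cross u v := by
  unfold cross; fun_prop

/-- Cramer's rule in the plane. -/
theorem cross_smul_eq (u v x : Plane) :
    cross u v • x = cross x v • u + cross u x • v := by
  ext k
  fin_cases k <;> simp [cross] <;> ring

/-- A point with both coordinates strictly inside is interior to the parallelogram. -/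
theorem mem_interior_parallelogram {C u v x : Plane} (h : 0 < cross u v)
    (h1 : 0 < cross (x - C) v) (h2 : cross (x - C) v < cross u v)
    (h3 : 0 < cross u (x - C)) (h4 : cross u (x - C) < cross u v) :
    x ∈ interior {y | ∃ a ∈ Set.Icc (0 : ℝ) 1, ∃ b ∈ Set.Icc (0 : ℝ) 1,
      y = C + a • u + b • v} := by
  have hc1 : Continuous fun y : Plane => cross (y - C) v :=
    (continuous_cross_left v).comp (continuous_id.sub continuous_const)
  have hc2 : Continuous fun y : Plane => cross u (y - C) :=
    (continuous_cross_right u).comp (continuous_id.sub continuous_const)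
  have hopen : IsOpen {y : Plane | (0 < cross (y - C) v ∧ cross (y - C) v < cross u v) ∧
      (0 < cross u (y - C) ∧ cross u (y - C) < cross u v)} :=
    ((isOpen_lt continuous_const hc1).inter (isOpen_lt hc1 continuous_const)).inter
      ((isOpen_lt continuous_const hc2).inter (isOpen_lt hc2 continuous_const))
  refine mem_interior.2 ⟨_, ?_, hopen, ⟨⟨h1, h2⟩, h3, h4⟩⟩
  rintro y ⟨⟨y1, y2⟩, y3, y4⟩
  refine ⟨cross (y - C) v / cross u v, ⟨by positivity, (div_le_one h).2 y2.le⟩,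
    cross u (y - C) / cross u v, ⟨by positivity, (div_le_one h).2 y4.le⟩, ?_⟩
  have key : y - C = (cross (y - C) v / cross u v) • u + (cross u (y - C) / cross u v) • v := by
    apply smul_right_injective Plane h.ne'
    simp only [smul_add, smul_smul, mul_div_cancel₀ _ h.ne']
    exact cross_smul_eq u v (y - C)
  rw [add_assoc, ← key]
  abel

/-- Interior points of a parallelogram have coordinates strictly between `0` and `1`. -/
theorem exists_of_mem_interior_parallelogram {C u v x : Plane} (h : cross u v ≠ 0)
    (hx : x ∈ interior {y | ∃ a ∈ Set.Icc (0 : ℝ) 1, ∃ b ∈ Set.Icc (0 : ℝ) 1,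
      y = C + a • u + b • v}) :
    ∃ a ∈ Set.Ioo (0 : ℝ) 1, ∃ b ∈ Set.Ioo (0 : ℝ) 1, x = C + a • u + b • v := by
  set S := {y | ∃ a ∈ Set.Icc (0 : ℝ) 1, ∃ b ∈ Set.Icc (0 : ℝ) 1, y = C + a • u + b • v}
  obtain ⟨a, ha, b, hb, hab⟩ := interior_subset hx
  -- An interior point can be moved a little both ways along any vector; along `u` and `v` this
  -- makes the coordinate bounds strict.
  have push : ∀ w : Plane, ∃ ε > (0 : ℝ), x + ε • w ∈ S ∧ x - ε • w ∈ S := by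
    intro w
    have hc : Filter.Tendsto (fun ε : ℝ => x + ε • w) (nhds 0) (nhds x) := by
      have : Continuous fun ε : ℝ => x + ε • w := by fun_prop
      simpa using this.tendsto 0
    have := hc (mem_interior_iff_mem_nhds.1 hx)
    obtain ⟨δ, hδ, hball⟩ := Metric.mem_nhds_iff.1 this
    refine ⟨δ / 2, by positivity, ?_, ?_⟩
    · exact hball (show δ / 2 ∈ Metric.ball 0 δ by
        simp [abs_of_pos hδ]; linarith)
    · have := hball (show -(δ / 2) ∈ Metric.ball 0 δ by
        simp [abs_of_pos hδ]; linarith)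
      simpa [sub_eq_add_neg] using this
  have coord : ∀ {a b a' b' : ℝ} {d : Plane}, C + a • u + b • v + d = C + a' • u + b' • v →
      a * cross u v + cross d v = a' * cross u v ∧ b * cross u v + cross u d = b' * cross u v := by
    intro a b a' b' d he
    constructor
    · have := congrArg (fun z => cross z v) he
      simp only [cross_add_left, cross_smul_left, cross_same] at this
      linarith
    · have := congrArg (fun z => cross u z) he
      simp only [cross_add_right, cross_smul_right, cross_same] at this
      linarith
  refine ⟨a, ?_, b, ?_, hab⟩
  · obtain ⟨ε, hε, ⟨a1, h1, b1, -, e1⟩, ⟨a2, h2, b2, -, e2⟩⟩ := push u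
    rw [hab] at e1 e2
    rw [sub_eq_add_neg] at e2
    have k1 := (coord e1).1
    have k2 := (coord e2).1
    rw [cross_smul_left, ← add_mul] at k1
    rw [cross_neg_left, cross_smul_left, ← neg_mul, ← add_mul] at k2
    have k1 := mul_right_cancel₀ h k1
    have k2 := mul_right_cancel₀ h k2
    exact ⟨by linarith [h2.1], by linarith [h1.2]⟩
  · obtain ⟨ε, hε, ⟨a1, -, b1, h1, e1⟩, ⟨a2, -, b2, h2, e2⟩⟩ := push v
    rw [hab] at e1 e2
    rw [sub_eq_add_neg] at e2
    have k1 := (coord e1).2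
    have k2 := (coord e2).2
    rw [cross_smul_right, ← add_mul] at k1
    rw [cross_neg_right, cross_smul_right, ← neg_mul, ← add_mul] at k2
    have k1 := mul_right_cancel₀ h k1
    have k2 := mul_right_cancel₀ h k2
    exact ⟨by linarith [h2.1], by linarith [h1.2]⟩

/-! ### The polygon as a periodic sequence of directions and vertices. -/

namespace ElnitskyDrawing

variable {n : ℕ} (P : ElnitskyDrawing n)

theorem side_injective_of_cross {i j : Fin n} (h : cross (P.side i) (P.side j) = 0) : i = j := by
  rcases lt_trichotomy i j with hij | hij | hij
  · exact absurd h (P.convex i j hij).ne'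
  · exact hij
  · rw [cross_swap, neg_eq_zero] at h
    exact absurd h (P.convex j i hij).ne'

theorem leftVertex_succ {k : ℕ} (hk : k < n) :
    P.leftVertex (k + 1) = P.leftVertex k + P.side ⟨k, hk⟩ := by
  have : (Finset.univ.filter fun i : Fin n => i.val < k + 1) =
      insert ⟨k, hk⟩ (Finset.univ.filter fun i : Fin n => i.val < k) := by
    ext i; simp [Fin.ext_iff]; omega
  rw [leftVertex, leftVertex, this, Finset.sum_insert (by simp)]
  abel

theorem rightVertex_succ (w : Equiv.Perm (Fin n)) {k : ℕ} (hk : k < n) :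
    P.rightVertex w (k + 1) = P.rightVertex w k + P.side (w ⟨k, hk⟩) := by
  have : (Finset.univ.filter fun i : Fin n => i.val < k + 1) =
      insert ⟨k, hk⟩ (Finset.univ.filter fun i : Fin n => i.val < k) := by
    ext i; simp [Fin.ext_iff]; omega
  rw [rightVertex, rightVertex, this, Finset.sum_insert (by simp)]
  abel

section Cyclic

variable [NeZero n]

/-- The side vectors of the polygon in counterclockwise order, continued periodically. -/
noncomputable def dir (k : ℕ) : Plane := (-1 : ℝ) ^ (k / n) • P.side (Fin.ofNat n k)

/-- The vertices of the polygon in counterclockwise order, continued periodically. -/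
noncomputable def vtx (k : ℕ) : Plane := P.top + ∑ i ∈ Finset.range k, P.dir i

theorem dir_val (i : Fin n) : P.dir i = P.side i := by
  have : Fin.ofNat n i.val = i := Fin.ext (by simp)
  rw [dir, Nat.div_eq_of_lt i.isLt, this]; simp

theorem dir_of_lt {k : ℕ} (h : k < n) : P.dir k = P.side ⟨k, h⟩ := P.dir_val ⟨k, h⟩

theorem dir_add (k : ℕ) : P.dir (k + n) = -P.dir k := by
  have : Fin.ofNat n (k + n) = Fin.ofNat n k := Fin.ext (by simp)
  rw [dir, dir, this, Nat.add_div_right _ (NeZero.pos n), pow_succ]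
  simp

theorem dir_add_two_mul (k : ℕ) : P.dir (k + 2 * n) = P.dir k := by
  rw [two_mul, ← add_assoc, dir_add, dir_add, neg_neg]

/-- The directions turn counterclockwise by half a turn every `n` steps; the sign rule `dir_add`
reduces all indices to the convexity axiom for labels. -/
theorem cross_dir_pos {p q : ℕ} (h : p < q) (h' : q < p + n) :
    0 < cross (P.dir p) (P.dir q) := by
  induction p using Nat.strong_induction_on generalizing q with
  | _ p ih =>
    rcases lt_or_ge p n with hp | hp
    · rcases lt_or_ge q n with hq | hq
      · rw [P.dir_of_lt hp, P.dir_of_lt hq]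
        exact P.convex _ _ h
      · obtain ⟨r, rfl⟩ := Nat.exists_eq_add_of_le' hq
        rw [P.dir_add, cross_neg_right, ← cross_swap, P.dir_of_lt hp, P.dir_of_lt (by omega)]
        exact P.convex _ _ (show r < p by omega)
    · obtain ⟨r, rfl⟩ := Nat.exists_eq_add_of_le' hp
      obtain ⟨s, rfl⟩ := Nat.exists_eq_add_of_le' (show n ≤ q by omega)
      rw [P.dir_add, P.dir_add, cross_neg_left, cross_neg_right, neg_neg]
      exact ih r (by have := NeZero.pos n; omega) (by omega) (by omega)

theorem cross_dir_nonneg {p q : ℕ} (h : p ≤ q) (h' : q ≤ p + n) :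
    0 ≤ cross (P.dir p) (P.dir q) := by
  rcases h.eq_or_lt with rfl | h
  · rw [cross_same]
  rcases h'.eq_or_lt with rfl | h'
  · rw [dir_add, cross_neg_right, cross_same, neg_zero]
  exact (P.cross_dir_pos h h').le

theorem mod_eq_of_cross_dir {p q : ℕ} (h : cross (P.dir p) (P.dir q) = 0) : p ≡ q [MOD n] := by
  rw [dir, dir, cross_smul_left, cross_smul_right] at h
  have h1 : ∀ k : ℕ, ((-1 : ℝ)) ^ k ≠ 0 := fun k => pow_ne_zero _ (by norm_num)
  have := P.side_injective_of_cross ((mul_eq_zero_iff_left (h1 _)).1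
    ((mul_eq_zero_iff_left (h1 _)).1 h))
  exact Fin.ext_iff.1 this

theorem vtx_zero : P.vtx 0 = P.top := by simp [vtx]

theorem vtx_succ (k : ℕ) : P.vtx (k + 1) = P.vtx k + P.dir k := by
  rw [vtx, vtx, Finset.sum_range_succ, add_assoc]

/-- Central symmetry: opposite chains of sides have opposite sums. With `r = n` it shows that the
polygon closes up. -/
theorem vtx_add_sub (k r : ℕ) : P.vtx (k + n + r) - P.vtx (k + n) = P.vtx k - P.vtx (k + r) := by
  induction r with
  | zero => simp
  | succ r ih =>
    rw [← add_assoc, vtx_succ, ← add_assoc, vtx_succ, add_right_comm k n r, dir_add,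
      ← add_right_comm k n r]
    linear_combination (norm := module) (1 : ℝ) • ih

theorem vtx_add_two_mul (k : ℕ) : P.vtx (k + 2 * n) = P.vtx k := by
  have := P.vtx_add_sub k n
  rw [two_mul, ← add_assoc]
  linear_combination (norm := module) (1 : ℝ) • this

theorem vtx_congr {a b : ℕ} (h : a ≡ b [MOD 2 * n]) : P.vtx a = P.vtx b := by
  have : ∀ k q : ℕ, P.vtx (k + 2 * n * q) = P.vtx k := by
    intro k q
    induction q with
    | zero => simp
    | succ q ih => rw [mul_add, mul_one, ← add_assoc, vtx_add_two_mul, ih]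
  rw [← Nat.mod_add_div a (2 * n), ← Nat.mod_add_div b (2 * n), this, this, show _ % _ = _ from h]

/-- The height above the line of side `e` does not decrease while the directions stay within half a
turn of `dir e`. -/
theorem cross_vtx_mono (e : ℕ) {r s : ℕ} (h : r ≤ s) (hs : s ≤ n) :
    cross (P.dir e) (P.vtx (e + r) - P.vtx e) ≤ cross (P.dir e) (P.vtx (e + s) - P.vtx e) := by
  induction s, h using Nat.le_induction with
  | base => exact le_rfl
  | succ s h ih =>
    refine (ih (by omega)).trans ?_
    rw [← add_assoc, vtx_succ, add_sub_right_comm, cross_add_right]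
    linarith [P.cross_dir_nonneg (show e ≤ e + s by omega) (by omega)]

/-- All vertices lie in the half-plane of each side. -/
theorem cross_vtx_nonneg (e f : ℕ) : 0 ≤ cross (P.dir e) (P.vtx f - P.vtx e) := by
  have main : ∀ r, r < 2 * n → 0 ≤ cross (P.dir e) (P.vtx (e + r) - P.vtx e) := by
    intro r hr
    rcases le_total r n with h | h
    · have := P.cross_vtx_mono e (Nat.zero_le r) h
      simpa [cross_zero_right] using this
    · obtain ⟨s, rfl⟩ := Nat.exists_eq_add_of_le h
      -- On the second half of the circuit the height is the total height minus one already reached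
      -- on the first half.
      have h1 := P.vtx_add_sub e s
      have h2 := P.cross_vtx_mono e (show s ≤ n by omega) le_rfl
      rw [← add_assoc, show P.vtx (e + n + s) - P.vtx e =
        (P.vtx (e + n) - P.vtx e) - (P.vtx (e + s) - P.vtx e) by
          linear_combination (norm := module) (1 : ℝ) • h1, cross_sub_right]
      linarith
  have hn := NeZero.pos n
  -- Adding `2 * n * e` to `f` keeps the natural-number subtraction of `e` from truncating.
  have : P.vtx f = P.vtx (e + (f + 2 * n * e - e) % (2 * n)) := by
    apply P.vtx_congr
    have h1 : f + 2 * n * e ≡ f [MOD 2 * n] := by simp [Nat.ModEq]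
    have h2 : e ≤ f + 2 * n * e := by nlinarith
    have h3 : e + (f + 2 * n * e - e) % (2 * n) ≡ e + (f + 2 * n * e - e) [MOD 2 * n] :=
      Nat.ModEq.add_left _ (Nat.mod_modEq _ _)
    rw [Nat.add_sub_cancel' h2] at h3
    exact (h3.trans h1).symm
  rw [this]
  exact main _ (Nat.mod_lt _ (by omega))

/-- If two vertices coincide, the half-planes of the sides leaving them force these sides to be
parallel; vertex `a + 2` then rules out opposite directions. -/
theorem vtx_injective (hn : 2 < n) {a b : ℕ} (h : P.vtx a = P.vtx b) : a ≡ b [MOD 2 * n] := by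
  wlog hab : a ≤ b generalizing a b
  · exact (this h.symm (by omega)).symm
  have h1 := P.cross_vtx_nonneg a (b + 1)
  have h2 := P.cross_vtx_nonneg b (a + 1)
  rw [vtx_succ, h, add_sub_cancel_left] at h1
  rw [vtx_succ, h, add_sub_cancel_left, cross_swap] at h2
  have hmod := P.mod_eq_of_cross_dir (le_antisymm (by linarith) h1)
  obtain ⟨q, hq⟩ := (Nat.modEq_iff_dvd' hab).1 hmod
  obtain rfl : b = a + n * q := by omega
  rcases Nat.even_or_odd' q with ⟨r, rfl | rfl⟩
  · rw [show a + n * (2 * r) = a + 2 * n * r by ring]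
    simp [Nat.ModEq]
  · exfalso
    have hd : P.dir (a + n * (2 * r + 1)) = -P.dir a := by
      have : ∀ r, P.dir (a + n * (2 * r)) = P.dir a := by
        intro r
        induction r with
        | zero => simp
        | succ r ih => rw [show a + n * (2 * (r + 1)) = a + n * (2 * r) + 2 * n by ring,
            dir_add_two_mul, ih]
      rw [mul_add, mul_one, ← add_assoc, dir_add, this]
    have h3 := P.cross_vtx_nonneg (a + n * (2 * r + 1)) (a + 2)
    rw [hd, ← h, show a + 2 = a + 1 + 1 by ring, vtx_succ, vtx_succ, add_assoc,
      add_sub_cancel_left, cross_neg_left, cross_add_right, cross_same] at h3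
    linarith [P.cross_dir_pos (show a < a + 1 by omega) (by omega)]

theorem leftVertex_eq_vtx {k : ℕ} (hk : k ≤ n) : P.leftVertex k = P.vtx k := by
  induction k with
  | zero => simp [leftVertex, vtx]
  | succ k ih => rw [leftVertex_succ P hk, ih (by omega), vtx_succ, dir_of_lt P hk]

theorem rightVertex_eq_vtx {k : ℕ} (hk : k ≤ n) :
    P.rightVertex (longestElement n) k = P.vtx (2 * n - k) := by
  induction k with
  | zero => simpa [rightVertex, vtx_zero] using (P.vtx_add_two_mul 0).symm
  | succ k ih =>
    rw [rightVertex_succ P _ hk, ih (by omega), show 2 * n - k = 2 * n - (k + 1) + 1 by omega,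
      vtx_succ, show 2 * n - (k + 1) = (n - (k + 1)) + n by omega, dir_add,
      P.dir_of_lt (show n - (k + 1) < n by omega)]
    have : longestElement n ⟨k, hk⟩ = ⟨n - (k + 1), by omega⟩ := by
      ext; simp [longestElement, Fin.revPerm]
    rw [this]
    abel

theorem longestBoundary_subset {S : Set Plane}
    (h : ∀ e, segment ℝ (P.vtx e) (P.vtx (e + 1)) ⊆ S) : P.longestBoundary ⊆ S := by
  refine Set.union_subset (Set.iUnion_subset fun k => ?_) (Set.iUnion_subset fun k => ?_)
  · rw [P.leftVertex_eq_vtx k.isLt.le, P.leftVertex_eq_vtx k.isLt]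
    exact h k
  · rw [P.rightVertex_eq_vtx k.isLt.le, P.rightVertex_eq_vtx k.isLt, segment_symm,
      show 2 * n - k.val = 2 * n - (k.val + 1) + 1 by omega]
    exact h _

theorem segment_subset_longestBoundary {e : ℕ} (he : e < 2 * n) :
    segment ℝ (P.vtx e) (P.vtx (e + 1)) ⊆ P.longestBoundary := by
  rcases lt_or_ge e n with h | h
  · refine Set.subset_union_of_subset_left ?_ _
    have := Set.subset_iUnion (fun k : Fin n =>
      segment ℝ (P.leftVertex k) (P.leftVertex (k + 1))) ⟨e, h⟩
    rwa [P.leftVertex_eq_vtx h.le, P.leftVertex_eq_vtx h] at this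
  · refine Set.subset_union_of_subset_right ?_ _
    have hk : 2 * n - 1 - e < n := by omega
    have := Set.subset_iUnion (fun k : Fin n => segment ℝ (P.rightVertex (longestElement n) k)
      (P.rightVertex (longestElement n) (k + 1))) ⟨2 * n - 1 - e, hk⟩
    rwa [P.rightVertex_eq_vtx hk.le, P.rightVertex_eq_vtx hk, segment_symm,
      show 2 * n - (2 * n - 1 - e + 1) = e by omega,
      show 2 * n - (2 * n - 1 - e) = e + 1 by omega] at this

theorem cross_nonneg_of_mem_longestRegion {x : Plane} (hx : x ∈ P.longestRegion) (e : ℕ) :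
    0 ≤ cross (P.dir e) (x - P.vtx e) := by
  have hconv : Convex ℝ {y : Plane | 0 ≤ cross (P.dir e) (y - P.vtx e)} := by
    intro y hy z hz a b ha hb hab
    have : a • y + b • z - P.vtx e = a • (y - P.vtx e) + b • (z - P.vtx e) := by
      have : P.vtx e = (a + b) • P.vtx e := by rw [hab, one_smul]
      nth_rw 1 [this]
      module
    simp only [Set.mem_ofPred_eq] at hy hz ⊢
    rw [this, cross_add_right, cross_smul_right, cross_smul_right]
    positivity
  refine convexHull_min (P.longestBoundary_subset fun f => ?_) hconv hx
  exact hconv.segment_subset (P.cross_vtx_nonneg e f) (P.cross_vtx_nonneg e (f + 1))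

/-- A unit step along a side inside the region starts at the vertex. -/
theorem eq_vtx_of_mem_longestRegion (hn : 2 < n) {e : ℕ} (he : 0 < e) {y : Plane}
    (h1 : y ∈ P.longestRegion) (h2 : y + P.dir e ∈ P.longestRegion)
    (h0 : cross (P.dir e) (y - P.vtx e) = 0) : y = P.vtx e := by
  obtain ⟨f, rfl⟩ := Nat.exists_eq_succ_of_ne_zero he.ne'
  have p1 := P.cross_dir_pos (show f < f + 1 by omega) (by omega)
  have p2 := P.cross_dir_pos (show f + 1 < f + 2 by omega) (by omega)
  have a1 := P.cross_nonneg_of_mem_longestRegion h1 f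
  have a2 := P.cross_nonneg_of_mem_longestRegion h2 (f + 2)
  set d := y - P.vtx (f + 1) with hd
  have b1 : 0 ≤ cross (P.dir f) d := by
    rwa [show y - P.vtx f = d + P.dir f by rw [hd, vtx_succ]; abel, cross_add_right, cross_same,
      add_zero] at a1
  have b2 : 0 ≤ cross (P.dir (f + 2)) d := by
    rwa [show y + P.dir (f + 1) - P.vtx (f + 2) = d by
      rw [hd, show f + 2 = f + 1 + 1 by ring, vtx_succ]; abel] at a2
  -- By Cramer `d` is a multiple of `dir (f + 1)`. The half-plane of the preceding side makes the
  -- factor nonnegative, that of the following side makes it nonpositive.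
  have key := cross_smul_eq (P.dir f) (P.dir (f + 1)) d
  rw [cross_swap d, h0, neg_zero, zero_smul, zero_add] at key
  have k2 := congrArg (cross (P.dir (f + 2))) key
  rw [cross_smul_right, cross_smul_right, cross_swap (P.dir (f + 2)) (P.dir (f + 1))] at k2
  have hz : cross (P.dir f) d = 0 := by
    refine le_antisymm ?_ b1
    by_contra hcon
    push Not at hcon
    nlinarith [mul_pos hcon p2, mul_nonneg p1.le b2]
  rw [hz, zero_smul] at key
  exact sub_eq_zero.1 ((smul_eq_zero_iff_right p1.ne').1 key)

end Cyclic

end ElnitskyDrawing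

/-! ### Tiles along the boundary and the lower bound. -/

/-- The parallelogram with corner `C` spanned by `u` and `v`. -/
def pgram (C u v : Plane) : Set Plane :=
  {y | ∃ a ∈ Set.Icc (0 : ℝ) 1, ∃ b ∈ Set.Icc (0 : ℝ) 1, y = C + a • u + b • v}

theorem pgram_rotate (C u v : Plane) : pgram C u v = pgram (C + u) v (-u) := by
  ext x
  constructor
  · rintro ⟨a, ha, b, hb, rfl⟩
    exact ⟨b, hb, 1 - a, ⟨by linarith [ha.2], by linarith [ha.1]⟩, by module⟩
  · rintro ⟨a, ha, b, hb, rfl⟩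
    exact ⟨1 - b, ⟨by linarith [hb.2], by linarith [hb.1]⟩, a, ha, by module⟩

namespace ElnitskyDrawing

variable {n : ℕ} (P : ElnitskyDrawing n)

theorem carrier_eq_pgram (t : RhombusTile n) :
    P.carrier t = pgram t.vertex (P.side t.i) (P.side t.j) := rfl

theorem corner_add_corner (t : RhombusTile n) (k : Fin 4) :
    P.corner t k + P.corner t (k + 2) = P.corner t (k + 1) + P.corner t (k + 3) := by
  fin_cases k <;> simp [corner] <;> abel

theorem corner_injective (t : RhombusTile n) : Function.Injective (P.corner t) := by
  have h := P.convex _ _ t.lt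
  have h0 : cross (P.side t.j) (P.side t.i) < 0 := by rw [cross_swap]; linarith
  have key : ∀ k l : Fin 4, k < l → P.corner t k ≠ P.corner t l := by
    intro k l hkl he
    have e1 := congrArg (fun z => cross (P.side t.i) (z - t.vertex)) he
    have e2 := congrArg (fun z => cross (P.side t.j) (z - t.vertex)) he
    fin_cases k <;> fin_cases l <;>
      simp [corner, cross_add_right, cross_sub_right, cross_same, cross_zero_right] at e1 e2 hkl <;> linarith
  intro k l he
  rcases lt_trichotomy k l with hkl | hkl | hkl
  · exact absurd he (key k l hkl)
  · exact hkl
  · exact absurd he.symm (key l k hkl)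

section Cyclic

variable [NeZero n]

/-- The edge of the tile `t` from its corner number `k` to the next one is the side number `e` of
the polygon, and the other edges of `t` at this side have direction number `m`. -/
structure IsFlag (t : RhombusTile n) (k : Fin 4) (e m : ℕ) : Prop where
  lt : e < m
  lt_add : m < e + n
  corner_eq : P.corner t k = P.vtx e
  corner_succ_eq : P.corner t (k + 1) = P.vtx (e + 1)
  carrier_eq : P.carrier t = pgram (P.vtx e) (P.dir e) (P.dir m)

variable {P}

/-- The tile seen from the far end of its side, where its angle runs from `dir m` to `dir (e + n)`.
-/
theorem IsFlag.carrier_eq_succ {t : RhombusTile n} {k : Fin 4} {e m : ℕ} (h : P.IsFlag t k e m) :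
    P.carrier t = pgram (P.vtx (e + 1)) (P.dir m) (P.dir (e + n)) := by
  rw [h.carrier_eq, pgram_rotate, vtx_succ, dir_add]

theorem IsFlag.add_two_mul {t : RhombusTile n} {k : Fin 4} {e m : ℕ} (h : P.IsFlag t k e m) :
    P.IsFlag t k (e + 2 * n) (m + 2 * n) where
  lt := by have := h.lt; omega
  lt_add := by have := h.lt_add; omega
  corner_eq := by rw [vtx_add_two_mul, h.corner_eq]
  corner_succ_eq := by rw [add_right_comm, vtx_add_two_mul, h.corner_succ_eq]
  carrier_eq := by rw [vtx_add_two_mul, dir_add_two_mul, dir_add_two_mul, h.carrier_eq]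

/-- Heights above side `e` are nonnegative on the region, so a point of height zero puts the bottom
edge of the parallelogram on the line of the side, where `eq_vtx_of_mem_longestRegion` leaves it
only one place. -/
theorem eq_vtx_of_pgram_subset (hn : 2 < n) {e : ℕ} {C w x : Plane}
    (hsub : pgram C (P.dir e) w ⊆ P.longestRegion) (hx : x ∈ pgram C (P.dir e) w)
    (h0 : cross (P.dir e) (x - P.vtx e) = 0) (hw : 0 < cross (P.dir e) w) : C = P.vtx e := by
  obtain ⟨a, ha, b, hb, rfl⟩ := hx
  have hC : C ∈ P.longestRegion := hsub ⟨0, by simp, 0, by simp, by simp⟩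
  have hC1 : C + P.dir e ∈ P.longestRegion := hsub ⟨1, by simp, 0, by simp, by simp⟩
  have h1 := P.cross_nonneg_of_mem_longestRegion hC e
  rw [show C + a • P.dir e + b • w - P.vtx e = (C - P.vtx e) + a • P.dir e + b • w by abel,
    cross_add_right, cross_add_right, cross_smul_right, cross_smul_right, cross_same] at h0
  have h2 : cross (P.dir e) (C - P.vtx e) = 0 := by
    have := mul_nonneg hb.1 hw.le
    linarith
  -- A full turn is added so that the index is positive and a preceding side exists even for `e =
  -- 0`.
  rw [← P.vtx_add_two_mul e]
  rw [← P.vtx_add_two_mul e, ← P.dir_add_two_mul e] at h2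
  rw [← P.dir_add_two_mul e] at hC1
  exact P.eq_vtx_of_mem_longestRegion hn (by omega) hC hC1 h2

/-- Every side of the polygon is an edge of some tile. -/
theorem IsRhombicTiling.exists_isFlag (hn : 2 < n) {T : Finset (RhombusTile n)}
    (hT : P.IsRhombicTiling T) {e : ℕ} (he : e < 2 * n) :
    ∃ t ∈ T, ∃ k m, P.IsFlag t k e m := by
  have hdir : P.dir e ≠ 0 := by
    intro h
    have := P.cross_dir_pos (show e < e + 1 by omega) (by omega)
    rw [h, cross_zero_left] at this
    exact lt_irrefl _ this
  -- Tiles have finitely many corners, so some point `x` of the side is no corner; the tile covering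
  -- `x` is the one sought.
  have hfin : (⋃ t ∈ T, Set.range (P.corner t)).Finite :=
    T.finite_toSet.biUnion fun t _ => Set.finite_range _
  have hinf : ((fun a : ℝ => P.vtx e + a • P.dir e) '' Set.Icc 0 1).Infinite := by
    refine (Set.Icc_infinite zero_lt_one).image fun a _ b _ hab => ?_
    exact smul_left_injective ℝ hdir (add_left_cancel hab)
  obtain ⟨x, ⟨c, hc, rfl⟩, hx⟩ := hinf.exists_notMem_finite hfin
  have hreg : P.vtx e + c • P.dir e ∈ P.longestRegion := by
    refine subset_convexHull _ _ (P.segment_subset_longestBoundary he ?_)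
    rw [segment_eq_image']
    exact ⟨c, hc, by simp [vtx_succ]⟩
  have h0 : cross (P.dir e) (P.vtx e + c • P.dir e - P.vtx e) = 0 := by
    rw [add_sub_cancel_left, cross_smul_right, cross_same, mul_zero]
  rw [← hT.cover] at hreg
  simp only [Set.mem_iUnion] at hreg hx
  obtain ⟨t, ht, hxt⟩ := hreg
  simp only [not_exists] at hx
  have hxc := hx t ht
  set x := P.vtx e + c • P.dir e
  have hsub : P.carrier t ⊆ P.longestRegion := by
    rw [← hT.cover]; exact Set.subset_biUnion_of_mem (u := fun t => P.carrier t) ht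
  have hnn : ∀ y ∈ P.carrier t, 0 ≤ cross (P.dir e) (y - P.vtx e) :=
    fun y hy => P.cross_nonneg_of_mem_longestRegion (hsub hy) e
  have hij := P.convex _ _ t.lt
  have hji : 0 < cross (P.side t.j) (-P.side t.i) := by rwa [cross_neg_right, ← cross_swap]
  have hlt := t.lt
  have hi := t.i.isLt
  have hj := t.j.isLt
  -- The tile is read from each of its corners, so that any of its four edges can serve as the
  -- bottom edge.
  have e0 := P.carrier_eq_pgram t
  have e1 := e0.trans (pgram_rotate _ _ _)
  have e2 := e1.trans (pgram_rotate _ _ _)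
  have e3 := e2.trans (pgram_rotate _ _ _)
  rw [neg_neg] at e3
  have main : P.dir e = P.side t.i ∨ P.dir e = P.side t.j ∨
      P.dir e = -P.side t.i ∨ P.dir e = -P.side t.j → ∃ k m, P.IsFlag t k e m := by
    have hmod : ∀ l : Fin n, P.dir e = P.side l ∨ P.dir e = -P.side l →
        e = l ∨ e = l + n := by
      intro l hl
      have : e ≡ l [MOD n] := by
        apply P.mod_eq_of_cross_dir
        rw [dir_val]
        rcases hl with h | h <;> simp [h, cross_same, cross_neg_left]
      have h3 : e % n = l := Eq.trans (b := l % n) this (Nat.mod_eq_of_lt l.isLt)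
      rcases lt_or_ge e n with h | h
      · rw [Nat.mod_eq_of_lt h] at h3; exact Or.inl h3
      · rw [Nat.mod_eq_sub_mod h, Nat.mod_eq_of_lt (by omega)] at h3; omega
    have hne : ∀ l : Fin n, P.side l ≠ -P.side l := by
      intro l hl
      have h1 : P.dir l = P.dir (l + n) := by rw [dir_add, dir_val]; exact hl
      have h2 := P.cross_dir_pos (show l.val < l + 1 by omega) (by omega)
      rw [h1, dir_add, cross_neg_left] at h2
      linarith [P.cross_dir_pos (show l.val < l + 1 by omega) (by omega)]
    rintro (h | h | h | h)
    · have hC : t.vertex = P.vtx e := by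
        rw [← h] at e0 hij
        exact eq_vtx_of_pgram_subset hn (e0 ▸ hsub) (e0 ▸ hxt) h0 hij
      rcases hmod _ (Or.inl h) with hh | hh
      · refine ⟨0, t.j, by omega, by omega, hC, ?_, ?_⟩
        · rw [vtx_succ, ← hC, h]; rfl
        · rw [e0, hC, h, dir_val]
      · rw [hh, dir_add, dir_val] at h
        exact absurd h.symm (hne _)
    · have hC : t.vertex + P.side t.i = P.vtx e := by
        rw [← h] at e1 hji
        exact eq_vtx_of_pgram_subset hn (e1 ▸ hsub) (e1 ▸ hxt) h0 hji
      rcases hmod _ (Or.inl h) with hh | hh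
      · refine ⟨1, t.i + n, by omega, by omega, hC, ?_, ?_⟩
        · rw [vtx_succ, ← hC, h]; rfl
        · rw [e1, hC, h, dir_add, dir_val]
      · rw [hh, dir_add, dir_val] at h
        exact absurd h.symm (hne _)
    · have hij' : 0 < cross (-P.side t.i) (-P.side t.j) := by
        rwa [cross_neg_left, cross_neg_right, neg_neg]
      have hC : t.vertex + P.side t.i + P.side t.j = P.vtx e := by
        rw [← h] at e2 hij'
        exact eq_vtx_of_pgram_subset hn (e2 ▸ hsub) (e2 ▸ hxt) h0 hij'
      rcases hmod _ (Or.inr h) with hh | hh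
      · rw [hh, dir_val] at h
        exact absurd h (hne _)
      · refine ⟨2, t.j + n, by omega, by omega, hC, ?_, ?_⟩
        · rw [vtx_succ, ← hC, h]; simp [corner]; abel
        · rw [e2, hC, h, dir_add, dir_val]
    · have hji' : 0 < cross (-P.side t.j) (P.side t.i) := by
        rwa [cross_neg_right, ← cross_neg_left] at hji
      have hC : t.vertex + P.side t.i + P.side t.j + -P.side t.i = P.vtx e := by
        rw [← h] at e3 hji'
        exact eq_vtx_of_pgram_subset hn (e3 ▸ hsub) (e3 ▸ hxt) h0 hji'
      rcases hmod _ (Or.inr h) with hh | hh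
      · rw [hh, dir_val] at h
        exact absurd h (hne _)
      -- Here `e = j + n`, so the representative of `side i` strictly between `e` and `e + n` is `i
      -- + 2 * n`.
      · refine ⟨3, t.i + 2 * n, by omega, by omega, ?_, ?_, ?_⟩
        · rw [← hC]; simp [corner]; abel
        · rw [vtx_succ, ← hC, h]; simp [corner]; abel
        · rw [e3, hC, h, dir_add_two_mul, dir_val]
  refine ⟨t, ht, main ?_⟩
  -- With no edge parallel to the side, the height has nonzero slope in both tile coordinates, so
  -- its minimum zero occurs only at a corner, and `x` is none.
  by_contra hcon
  push Not at hcon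
  obtain ⟨n1, n2, n3, n4⟩ := hcon
  have par : ∀ l : Fin n, P.dir e ≠ P.side l → P.dir e ≠ -P.side l →
      cross (P.dir e) (P.side l) ≠ 0 := by
    intro l h1 h2 h
    rw [← dir_val] at h h1 h2
    have h3 : e % n = l := Eq.trans (b := l % n) (P.mod_eq_of_cross_dir h)
      (Nat.mod_eq_of_lt l.isLt)
    rcases lt_or_ge e n with h | h
    · rw [Nat.mod_eq_of_lt h] at h3; exact h1 (by rw [h3])
    · rw [Nat.mod_eq_sub_mod h, Nat.mod_eq_of_lt (by omega)] at h3
      exact h2 (by rw [← dir_add, ← h3, Nat.sub_add_cancel h])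
  have pi := par _ n1 n3
  have pj := par _ n2 n4
  obtain ⟨a, ha, b, hb, hab⟩ := hxt
  have f : ∀ a b : ℝ, cross (P.dir e) (t.vertex + a • P.side t.i + b • P.side t.j - P.vtx e) =
      cross (P.dir e) (t.vertex - P.vtx e) + a * cross (P.dir e) (P.side t.i) +
        b * cross (P.dir e) (P.side t.j) := by
    intro a b
    rw [← cross_smul_right, ← cross_smul_right, ← cross_add_right, ← cross_add_right]
    congr 1; abel
  have g : ∀ a ∈ Set.Icc (0 : ℝ) 1, ∀ b ∈ Set.Icc (0 : ℝ) 1,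
      0 ≤ cross (P.dir e) (t.vertex - P.vtx e) + a * cross (P.dir e) (P.side t.i) +
        b * cross (P.dir e) (P.side t.j) := fun a ha b hb => by
    rw [← f]; exact hnn _ ⟨a, ha, b, hb, rfl⟩
  rw [hab, f] at h0
  have end01 : ∀ s c : ℝ, c ≠ 0 → s ∈ Set.Icc (0 : ℝ) 1 → 0 ≤ -(s * c) → 0 ≤ (1 - s) * c →
      s = 0 ∨ s = 1 := by
    intro s c hc hs h1 h2
    rcases lt_or_gt_of_ne hc with h | h
    · right; nlinarith [hs.1, hs.2]
    · left; nlinarith [hs.1, hs.2]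
  have ia : a = 0 ∨ a = 1 := by
    apply end01 a _ pi ha
    · have := g 0 (by simp) b hb; linarith
    · have := g 1 (by simp) b hb; linarith
  have ib : b = 0 ∨ b = 1 := by
    apply end01 b _ pj hb
    · have := g a ha 0 (by simp); linarith
    · have := g a ha 1 (by simp); linarith
  apply hxc
  rcases ia with rfl | rfl <;> rcases ib with rfl | rfl
  · exact ⟨0, by rw [hab]; simp [corner]⟩
  · exact ⟨3, by rw [hab]; simp [corner]⟩
  · exact ⟨1, by rw [hab]; simp [corner]⟩
  · exact ⟨2, by rw [hab]; simp [corner]⟩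

/-- If neighbouring sides belong to different tiles, the angles of these tiles at the common
vertex do not overlap. -/
theorem IsFlag.le_of_disjoint {s t : RhombusTile n} {k l : Fin 4} {e m m' : ℕ}
    (hs : P.IsFlag s k e m) (ht : P.IsFlag t l (e + 1) m')
    (hd : Disjoint (interior (P.carrier s)) (interior (P.carrier t))) : m' ≤ m := by
  -- At `vtx (e + 1)` tile `s` fills the angle from `dir m` to `dir (e + n)` and `t` that from `dir
  -- (e + 1)` to `dir m'`. If `m < m'`, a short step along `dir m + dir m'` enters both interiors.
  by_contra! hlt
  have a1 := hs.lt
  have a2 := hs.lt_add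
  have a3 := ht.lt
  have a4 := ht.lt_add
  have hB1 := P.cross_dir_pos (show m < e + n by omega) (by omega)
  have hB2 := P.cross_dir_pos (show e + 1 < m' by omega) (by omega)
  have hmm := P.cross_dir_pos hlt (by omega)
  have hA1 := P.cross_dir_nonneg (show m' ≤ e + n by omega) (by omega)
  have hA2 := P.cross_dir_nonneg (show e + 1 ≤ m by omega) (by omega)
  -- `B` is the smaller of the two determinants and `A` bounds the cross products that occur; `ε * A
  -- < B` keeps all tile coordinates below `1`.
  set B := min (cross (P.dir m) (P.dir (e + n))) (cross (P.dir (e + 1)) (P.dir m')) with hB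
  have hBpos : 0 < B := lt_min hB1 hB2
  set A := cross (P.dir m) (P.dir (e + n)) + cross (P.dir m') (P.dir (e + n)) +
    cross (P.dir m) (P.dir m') + cross (P.dir (e + 1)) (P.dir m) +
    cross (P.dir (e + 1)) (P.dir m') with hA
  have hApos : 0 < A := by positivity
  obtain ⟨ε, hε, hεA⟩ : ∃ ε > (0 : ℝ), ε * A < B := by
    refine ⟨B / 2 / A, by positivity, ?_⟩
    rw [div_mul_cancel₀ _ hApos.ne']
    linarith
  have hBl : B ≤ _ := min_le_left _ _
  have hBr : B ≤ _ := min_le_right _ _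
  have bound : ∀ z, 0 < z → z ≤ A → 0 < ε * z ∧ ε * z < B := fun z hz hzA =>
    ⟨by positivity, (mul_le_mul_of_nonneg_left hzA hε.le).trans_lt hεA⟩
  have x1 := bound (cross (P.dir m) (P.dir (e + n)) + cross (P.dir m') (P.dir (e + n)))
    (by linarith) (by rw [hA]; linarith)
  have x2 := bound (cross (P.dir m) (P.dir m')) hmm (by rw [hA]; linarith)
  have x3 := bound (cross (P.dir (e + 1)) (P.dir m) + cross (P.dir (e + 1)) (P.dir m'))
    (by linarith) (by rw [hA]; linarith)
  refine Set.disjoint_left.1 hd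
    (?_ : P.vtx (e + 1) + ε • (P.dir m + P.dir m') ∈ interior (P.carrier s)) ?_
  · rw [hs.carrier_eq_succ]
    refine mem_interior_parallelogram hB1 ?_ ?_ ?_ ?_ <;>
      simp only [add_sub_cancel_left, cross_smul_left, cross_smul_right, cross_add_left,
        cross_add_right, cross_same, zero_add]
    exacts [x1.1, x1.2.trans_le hBl, x2.1, x2.2.trans_le hBl]
  · rw [ht.carrier_eq]
    refine mem_interior_parallelogram hB2 ?_ ?_ ?_ ?_ <;>
      simp only [add_sub_cancel_left, cross_smul_left, cross_smul_right, cross_add_left,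
        cross_add_right, cross_same, add_zero]
    exacts [x2.1, x2.2.trans_le hBr, x3.1, x3.2.trans_le hBr]

/-- A tile does not have three consecutive sides of the polygon as its edges. -/
theorem corner_add_three_ne (hn : 2 < n) {t : RhombusTile n} {k : Fin 4} {e : ℕ}
    (h0 : P.corner t k = P.vtx e) (h1 : P.corner t (k + 1) = P.vtx (e + 1))
    (h2 : P.corner t (k + 2) = P.vtx (e + 2)) : P.corner t (k + 3) ≠ P.vtx (e + 3) := by
  intro h3
  have h := P.corner_add_corner t k
  rw [h0, h1, h2, h3] at h
  have : P.dir (e + 2) = -P.dir e := by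
    rw [show e + 3 = e + 2 + 1 by ring, vtx_succ _ (e + 2), vtx_succ _ e] at h
    linear_combination (norm := module) (-1 : ℝ) • h
  have hp := P.cross_dir_pos (show e < e + 2 by omega) (by omega)
  rw [this, cross_neg_right, cross_same] at hp
  simp at hp

/-- Different vertices of the polygon do not have the same tile as their only tile. -/
theorem modEq_of_corners (hn : 2 < n) {t : RhombusTile n} {k l : Fin 4} {e f : ℕ}
    (h0 : P.corner t k = P.vtx e) (h1 : P.corner t (k + 1) = P.vtx (e + 1))
    (h2 : P.corner t (k + 2) = P.vtx (e + 2)) (g0 : P.corner t l = P.vtx f)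
    (g1 : P.corner t (l + 1) = P.vtx (f + 1)) (g2 : P.corner t (l + 2) = P.vtx (f + 2)) :
    e ≡ f [MOD 2 * n] := by
  have step : ∀ {k l : Fin 4} {e f : ℕ}, P.corner t k = P.vtx e →
      P.corner t (k + 1) = P.vtx (e + 1) → P.corner t (k + 2) = P.vtx (e + 2) →
      P.corner t l = P.vtx f → P.corner t (l + 2) = P.vtx (f + 2) → l ≠ k + 1 := by
    rintro k l e f h0 h1 h2 g0 g2 rfl
    have hm := P.vtx_injective hn (h1.symm.trans g0)
    apply corner_add_three_ne hn h0 h1 h2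
    rw [show k + 3 = k + 1 + 2 by rw [add_assoc]; rfl, g2]
    exact (P.vtx_congr (hm.add_right 2)).symm
  -- Unless `l = k`, the two paths of three corners together make all four corners consecutive
  -- polygon vertices.
  have h4 : l = k ∨ l = k + 1 ∨ l = k + 2 ∨ k = l + 1 := by
    clear * -
    revert k l; decide
  rcases h4 with rfl | h | rfl | h
  · exact P.vtx_injective hn (h0.symm.trans g0)
  · exact absurd h (step h0 h1 h2 g0 g2)
  · exfalso
    have hm := P.vtx_injective hn (h2.symm.trans g0)
    apply corner_add_three_ne hn h0 h1 h2
    rw [show k + 3 = k + 2 + 1 by rw [add_assoc]; rfl, g1]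
    exact (P.vtx_congr (hm.add_right 1)).symm
  · exact absurd h (step g0 g1 g2 h0 h2)

/-- Every rhombic tiling has at least three perimeter tiles. -/
theorem IsRhombicTiling.three_le_perim (hn : 2 < n) {T : Finset (RhombusTile n)}
    (hT : P.IsRhombicTiling T) : 3 ≤ P.perim T := by
  classical
  have hex : ∀ e : ℕ, ∃ t k m, t ∈ T ∧ (e < 2 * n → P.IsFlag t k e m) := by
    intro e
    rcases lt_or_ge e (2 * n) with he | he
    · obtain ⟨t, ht, k, m, h⟩ := hT.exists_isFlag hn he
      exact ⟨t, k, m, ht, fun _ => h⟩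
    · obtain ⟨t, ht, -⟩ := hT.exists_isFlag hn (show 0 < 2 * n by omega)
      exact ⟨t, 0, 0, ht, fun h => absurd h (by omega)⟩
  choose t₀ k₀ m₀ ht₀ hf₀ using hex
  set t : ℕ → RhombusTile n := fun e => t₀ (if e < 2 * n then e else 0) with ht
  set k : ℕ → Fin 4 := fun e => k₀ (if e < 2 * n then e else 0) with hk
  -- At `e = 2 * n` the first tile recurs with its direction number raised by a full turn, so the
  -- telescoping sum is `2 * n` rather than `0`.
  set m : ℕ → ℕ := fun e => if e < 2 * n then m₀ e else m₀ 0 + 2 * n with hm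
  have hf : ∀ e, e ≤ 2 * n → P.IsFlag (t e) (k e) e (m e) := by
    intro e he
    rcases he.lt_or_eq with h | rfl
    · simp only [ht, hk, hm, h, if_true]; exact hf₀ e h
    · simp only [ht, hk, hm, lt_irrefl, if_false]
      simpa using (hf₀ 0 (by omega)).add_two_mul
  have htT : ∀ e, t e ∈ T := fun e => ht₀ _
  set B := (Finset.range (2 * n)).filter fun e => t e = t (e + 1) with hB
  have hcard : 2 * n ≤ B.card * (n - 1) := by
    have hsum : ∑ e ∈ Finset.range (2 * n), ((m (e + 1) : ℤ) - m e) = 2 * n := by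
      rw [Finset.sum_range_sub (fun e => (m e : ℤ))]
      simp [hm, show 0 < n by omega]
    have hle : ∑ e ∈ Finset.range (2 * n), ((m (e + 1) : ℤ) - m e) ≤
        ∑ e ∈ Finset.range (2 * n), if t e = t (e + 1) then (n : ℤ) - 1 else 0 := by
      refine Finset.sum_le_sum fun e he => ?_
      have he := Finset.mem_range.1 he
      have f1 := hf e he.le
      have f2 := hf (e + 1) he
      split_ifs with h
      -- On a common tile `e + 1 ≤ m e` and `m (e + 1) ≤ e + n`.
      · have := f1.lt
        have := f2.lt_add
        omega
      · have := f1.le_of_disjoint f2 (hT.disjoint _ (htT e) _ (htT _) h)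
        omega
    rw [hsum, ← Finset.sum_filter, ← hB, Finset.sum_const, nsmul_eq_mul] at hle
    zify [show 1 ≤ n by omega]
    linarith
  have hB3 : 3 ≤ B.card := by
    by_contra hcon
    have : B.card * (n - 1) ≤ 2 * (n - 1) := Nat.mul_le_mul_right _ (by omega)
    omega
  have hpath : ∀ e ∈ B, P.corner (t e) (k e) = P.vtx e ∧
      P.corner (t e) (k e + 1) = P.vtx (e + 1) ∧ P.corner (t e) (k e + 2) = P.vtx (e + 2) := by
    intro e he
    obtain ⟨he, htt⟩ := Finset.mem_filter.1 he
    have he := Finset.mem_range.1 he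
    have f1 := hf e he.le
    have f2 := hf (e + 1) he
    rw [← htt] at f2
    have hkk : k (e + 1) = k e + 1 :=
      P.corner_injective (t e) (f2.corner_eq.trans f1.corner_succ_eq.symm)
    have h3 := f2.corner_succ_eq
    rw [hkk, add_assoc, add_assoc] at h3
    exact ⟨f1.corner_eq, f1.corner_succ_eq, h3⟩
  refine hB3.trans (Finset.card_le_card_of_injOn t ?_ ?_)
  · intro e he
    obtain ⟨h0, h1, h2⟩ := hpath e he
    have he' := Finset.mem_range.1 (Finset.mem_filter.1 he).1
    refine Finset.mem_coe.2 (Finset.mem_filter.2 ⟨htT e, k e, ?_, ?_⟩)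
    · rw [edge, h0, h1]
      exact P.segment_subset_longestBoundary he'
    · rw [edge, add_assoc, show (1 + 1 : Fin 4) = 2 from rfl, h1, h2]
      rcases Nat.lt_or_ge (e + 1) (2 * n) with h | h
      · exact P.segment_subset_longestBoundary h
      · have : e + 1 = 0 + 2 * n := by omega
        rw [this, show e + 2 = 0 + 1 + 2 * n by omega, vtx_add_two_mul, vtx_add_two_mul]
        exact P.segment_subset_longestBoundary (by omega)
  · intro e he f hfB hef
    obtain ⟨h0, h1, h2⟩ := hpath e he
    obtain ⟨g0, g1, g2⟩ := hpath f hfB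
    rw [← hef] at g0 g1 g2
    have := modEq_of_corners hn h0 h1 h2 g0 g1 g2
    rwa [Nat.ModEq, Nat.mod_eq_of_lt (Finset.mem_range.1 (Finset.mem_filter.1 he).1),
      Nat.mod_eq_of_lt (Finset.mem_range.1 (Finset.mem_filter.1 hfB).1)] at this

end Cyclic

end ElnitskyDrawing

/-! ### Cube faces as minimisers of the coefficient sum. -/

theorem cross_eq_zero_of_sameRay {u v : Plane} (h : SameRay ℝ u v) : cross u v = 0 := by
  rcases h with rfl | rfl | ⟨a, b, ha, hb, hab⟩
  · exact cross_zero_left _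
  · exact cross_zero_right _
  · have := congrArg (fun z => cross z v) hab
    simp only [cross_smul_left, cross_same, mul_zero] at this
    exact (mul_eq_zero_iff_left ha.ne').1 this

/-- The points in the cube `[0, 1]ⁿ` that are `1` between the coordinates `i` and `j`, and `0`
before `i` and after `j`. -/
def cubeFace {n : ℕ} (i j : Fin n) : Set (Fin n → ℝ) :=
  {c | (∀ l, c l ∈ Set.Icc (0 : ℝ) 1) ∧ (∀ l, i < l → l < j → c l = 1) ∧
    ∀ l, l < i ∨ j < l → c l = 0}

/-- The point of `cubeFace i j` with given coordinates at `i` and `j`. -/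
def facePoint {n : ℕ} (i j : Fin n) (a b : ℝ) (l : Fin n) : ℝ :=
  if l = i then a else if l = j then b else if i < l ∧ l < j then 1 else 0

theorem facePoint_left {n : ℕ} (i j : Fin n) (a b : ℝ) : facePoint i j a b i = a := by
  simp [facePoint]

theorem facePoint_right {n : ℕ} {i j : Fin n} (h : i < j) (a b : ℝ) :
    facePoint i j a b j = b := by
  simp [facePoint, h.ne']

theorem facePoint_mem {n : ℕ} {i j : Fin n} (h : i < j) {a b : ℝ} (ha : a ∈ Set.Icc (0 : ℝ) 1)
    (hb : b ∈ Set.Icc (0 : ℝ) 1) : facePoint i j a b ∈ cubeFace i j := by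
  refine ⟨fun l => ?_, fun l h1 h2 => ?_, fun l hl => ?_⟩
  · unfold facePoint; split_ifs <;> first | assumption | simp
  · simp [facePoint, h1.ne', h2.ne, h1, h2]
  · have h1 : l ≠ i := by rintro rfl; rcases hl with hl | hl <;> order
    have h2 : l ≠ j := by rintro rfl; rcases hl with hl | hl <;> order
    have h3 : ¬(i < l ∧ l < j) := by rintro ⟨h3, h4⟩; rcases hl with hl | hl <;> order
    simp [facePoint, h1, h2, h3]

theorem eq_facePoint_of_mem {n : ℕ} {i j : Fin n} {c : Fin n → ℝ}
    (hc : c ∈ cubeFace i j) : c = facePoint i j (c i) (c j) := by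
  funext l
  unfold facePoint
  split_ifs with h1 h2 h3
  · rw [h1]
  · rw [h2]
  · exact hc.2.1 l h3.1 h3.2
  · refine hc.2.2 l ?_
    by_contra! hcon
    exact h3 ⟨lt_of_le_of_ne hcon.1 (Ne.symm h1), lt_of_le_of_ne hcon.2 h2⟩

theorem facePoint_update_left {n : ℕ} (i j : Fin n) (a b x : ℝ) :
    Function.update (facePoint i j a b) i x = facePoint i j x b := by
  funext l
  by_cases h : l = i <;> simp [facePoint, h]

theorem facePoint_update_right {n : ℕ} {i j : Fin n} (hij : i < j) (a b x : ℝ) :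
    Function.update (facePoint i j a b) j x = facePoint i j a x := by
  funext l
  by_cases h : l = j
  · simp [facePoint, h, hij.ne']
  · simp [facePoint, h]

namespace ElnitskyDrawing

variable {n : ℕ} (P : ElnitskyDrawing n)

/-- Points of a circle are in strictly convex position. -/
theorem cross_lt_cross_add_cross {i l j : Fin n} (h1 : i < l) (h2 : l < j) :
    cross (P.side i) (P.side j) <
      cross (P.side l) (P.side j) + cross (P.side i) (P.side l) := by
  have hij := P.convex i j (h1.trans h2)
  have hil := P.convex i l h1
  have hlj := P.convex l j h2
  have hr : 0 < ‖P.side l‖ := by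
    rw [norm_pos_iff]
    intro h
    rw [h, cross_zero_right] at hil
    exact lt_irrefl _ hil
  -- Cramer's rule writes `side l` through `side i` and `side j`; with equal lengths, the claim is
  -- the strict triangle inequality.
  have key := congrArg norm (cross_smul_eq (P.side i) (P.side j) (P.side l))
  have hlt : ‖cross (P.side l) (P.side j) • P.side i + cross (P.side i) (P.side l) • P.side j‖ <
      ‖cross (P.side l) (P.side j) • P.side i‖ + ‖cross (P.side i) (P.side l) • P.side j‖ := by
    apply norm_add_lt_of_not_sameRay
    intro h
    have := cross_eq_zero_of_sameRay h
    rw [cross_smul_left, cross_smul_right] at this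
    have := mul_pos hlj (mul_pos hil hij)
    linarith
  rw [← key, norm_smul, norm_smul, norm_smul, P.equilateral i l, P.equilateral j l,
    Real.norm_of_nonneg hij.le, Real.norm_of_nonneg hil.le, Real.norm_of_nonneg hlj.le,
    ← add_mul] at hlt
  exact lt_of_mul_lt_mul_right hlt hr.le

/-- The point of the plane with given coefficients of the side vectors. -/
noncomputable def zpt (c : Fin n → ℝ) : Plane := P.top + ∑ l, c l • P.side l

theorem continuous_zpt : Continuous P.zpt := by
  unfold zpt; fun_prop

theorem zpt_combo {c c' : Fin n → ℝ} {a b : ℝ} (h : a + b = 1) :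
    P.zpt (a • c + b • c') = a • P.zpt c + b • P.zpt c' := by
  have : P.top = (a + b) • P.top := by rw [h, one_smul]
  unfold zpt
  nth_rw 1 [this]
  simp only [Pi.add_apply, Pi.smul_apply, smul_eq_mul, add_smul, mul_smul, smul_add,
    Finset.smul_sum, Finset.sum_add_distrib]
  abel

/-- The weight is an affine function of `side l` that vanishes at `side i` and `side j`. By strict
convexity of the circle it is positive for labels between them and negative outside, just where `c`
takes its extreme values `1` and `0`. -/
theorem facePoint_weight {i j : Fin n} (hij : i < j) {c c' : Fin n → ℝ} (hc : c ∈ cubeFace i j)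
    (hc' : ∀ l, c' l ∈ Set.Icc (0 : ℝ) 1) (l : Fin n) :
    0 ≤ (c l - c' l) *
      (cross (P.side l) (P.side j - P.side i) - cross (P.side i) (P.side j)) ∧
    ((c l - c' l) * (cross (P.side l) (P.side j - P.side i) -
      cross (P.side i) (P.side j)) = 0 → l ≠ i → l ≠ j → c l = c' l) := by
  rw [cross_sub_right]
  rcases lt_trichotomy l i with h | rfl | h
  · have h1 := P.cross_lt_cross_add_cross h hij
    rw [hc.2.2 l (Or.inl h)]
    refine ⟨mul_nonneg_of_nonpos_of_nonpos (by linarith [(hc' l).1]) (by linarith),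
      fun h0 _ _ => ?_⟩
    have := (mul_eq_zero_iff_right (by linarith)).1 h0
    linarith
  · refine ⟨le_of_eq ?_, fun _ h _ => absurd rfl h⟩
    rw [cross_same]; ring
  rcases lt_trichotomy l j with h' | rfl | h'
  · have h1 := P.cross_lt_cross_add_cross h h'
    rw [cross_swap (P.side l) (P.side i), hc.2.1 l h h']
    refine ⟨mul_nonneg (by linarith [(hc' l).2]) (by linarith), fun h0 _ _ => ?_⟩
    have := (mul_eq_zero_iff_right (by linarith)).1 h0
    linarith
  · refine ⟨le_of_eq ?_, fun _ _ h => absurd rfl h⟩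
    rw [cross_same, cross_swap (P.side i)]; ring
  · have h1 := P.cross_lt_cross_add_cross hij h'
    rw [hc.2.2 l (Or.inr h'), cross_swap (P.side l) (P.side i), cross_swap (P.side l) (P.side j)]
    refine ⟨mul_nonneg_of_nonpos_of_nonpos (by linarith [(hc' l).1]) (by linarith),
      fun h0 _ _ => ?_⟩
    have := (mul_eq_zero_iff_right (by linarith)).1 h0
    linarith

/-- The points of the faces `cubeFace i j` minimise the sum of the coefficients, and they are the
only minimisers. -/
theorem sum_le_of_mem_cubeFace {i j : Fin n} (hij : i < j) {c c' : Fin n → ℝ}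
    (hc : c ∈ cubeFace i j) (hc' : ∀ l, c' l ∈ Set.Icc (0 : ℝ) 1) (h : P.zpt c = P.zpt c') :
    ∑ l, c l ≤ ∑ l, c' l ∧ (∑ l, c l = ∑ l, c' l → c = c') := by
  have hpos := P.convex i j hij
  have hz : ∑ l, (c l - c' l) • P.side l = 0 := by
    have := add_left_cancel h
    simp only [sub_smul, Finset.sum_sub_distrib, this, sub_self]
  have hw := P.facePoint_weight hij hc hc'
  -- The linear part of the weight cancels because both points have the same image; only the
  -- difference of the coefficient sums is left.
  have hsum : ∑ l, (c l - c' l) *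
      (cross (P.side l) (P.side j - P.side i) - cross (P.side i) (P.side j)) =
      -cross (P.side i) (P.side j) * (∑ l, c l - ∑ l, c' l) := by
    have h1 := congrArg (fun z => cross z (P.side j - P.side i)) hz
    simp only [cross_sum_left, cross_smul_left, cross_zero_left] at h1
    have h2 : ∀ l, (c l - c' l) *
        (cross (P.side l) (P.side j - P.side i) - cross (P.side i) (P.side j)) =
        (c l - c' l) * cross (P.side l) (P.side j - P.side i) -
          (c l * cross (P.side i) (P.side j) - c' l * cross (P.side i) (P.side j)) :=
      fun l => by ring
    rw [Finset.sum_congr rfl fun l _ => h2 l, Finset.sum_sub_distrib, h1,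
      Finset.sum_sub_distrib, ← Finset.sum_mul, ← Finset.sum_mul]
    ring
  have hnn := Finset.sum_nonneg fun l (_ : l ∈ Finset.univ) => (hw l).1
  constructor
  · rw [hsum] at hnn
    nlinarith
  · intro heq
    rw [heq, sub_self, mul_zero] at hsum
    have h0 := (Finset.sum_eq_zero_iff_of_nonneg fun l _ => (hw l).1).1 hsum
    have hne : ∀ l, l ≠ i → l ≠ j → c l = c' l :=
      fun l => (hw l).2 (h0 l (Finset.mem_univ l))
    have htwo : ∑ l, (c l - c' l) • P.side l =
        (c i - c' i) • P.side i + (c j - c' j) • P.side j := by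
      rw [← Finset.sum_pair (f := fun l => (c l - c' l) • P.side l) hij.ne]
      symm
      refine Finset.sum_subset (Finset.subset_univ _) fun l _ hl => ?_
      simp only [Finset.mem_insert, Finset.mem_singleton, not_or] at hl
      rw [hne l hl.1 hl.2, sub_self, zero_smul]
    rw [htwo] at hz
    have hi := congrArg (fun z => cross z (P.side j)) hz
    have hj := congrArg (fun z => cross (P.side i) z) hz
    simp only [cross_add_left, cross_add_right, cross_smul_left, cross_smul_right, cross_same,
      cross_zero_left, cross_zero_right, mul_zero, add_zero, zero_add, mul_eq_zero, hpos.ne',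
      or_false] at hi hj
    funext l
    by_cases h1 : l = i
    · subst h1; linarith
    by_cases h2 : l = j
    · subst h2; linarith
    exact hne l h1 h2

/-- Each point minimises the coefficient sum over the common fibre, so the sums agree. This
uniqueness is what keeps tiles from overlapping and makes edges match. -/
theorem eq_of_zpt_eq {i j i' j' : Fin n} (hij : i < j) (hij' : i' < j') {c c' : Fin n → ℝ}
    (hc : c ∈ cubeFace i j) (hc' : c' ∈ cubeFace i' j') (h : P.zpt c = P.zpt c') : c = c' := by
  have h1 := P.sum_le_of_mem_cubeFace hij hc hc'.1 h
  have h2 := P.sum_le_of_mem_cubeFace hij' hc' hc.1 h.symm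
  exact h1.2 (le_antisymm h1.1 h2.1)

/-- Every point of the zonotope has coefficients in one of the faces. -/
theorem exists_mem_cubeFace (hn : 2 < n) {c : Fin n → ℝ} (hc : ∀ l, c l ∈ Set.Icc (0 : ℝ) 1) :
    ∃ i j : Fin n, i < j ∧ ∃ c' ∈ cubeFace i j, P.zpt c' = P.zpt c := by
  set S := Set.univ.pi (fun _ : Fin n => Set.Icc (0 : ℝ) 1) ∩ P.zpt ⁻¹' {P.zpt c} with hS
  have hcomp : IsCompact S :=
    (isCompact_univ_pi fun _ => isCompact_Icc).inter_right
      (isClosed_singleton.preimage P.continuous_zpt)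
  obtain ⟨d, ⟨hd, hdz⟩, hmin⟩ := hcomp.exists_isMinOn ⟨c, fun l _ => hc l, rfl⟩
    (f := fun c => ∑ l, c l) (by fun_prop)
  have hd : ∀ l, d l ∈ Set.Icc (0 : ℝ) 1 := fun l => hd l trivial
  -- Otherwise adding `g`, which trades `side i` and `side j` for `side l`, would stay in the fibre
  -- and lower the sum, because `D < α + β`.
  have htriple : ∀ i l j, i < l → l < j → 0 < d i → 0 < d j → d l = 1 := by
    intro i l j hil hlj hi hj
    by_contra hne
    have hl : d l < 1 := lt_of_le_of_ne (hd l).2 hne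
    have hK := P.cross_lt_cross_add_cross hil hlj
    have p1 := P.convex _ _ hil
    have p2 := P.convex _ _ hlj
    have p3 := P.convex _ _ (hil.trans hlj)
    have hcr := cross_smul_eq (P.side i) (P.side j) (P.side l)
    set α := cross (P.side l) (P.side j)
    set β := cross (P.side i) (P.side l)
    set D := cross (P.side i) (P.side j)
    set M := min (d i) (min (d j) (1 - d l)) with hM
    have hMpos : 0 < M := lt_min hi (lt_min hj (by linarith))
    -- `M` is the room left at the three coefficients, so a step of this size stays in the cube.
    obtain ⟨ε, hε, hεM⟩ : ∃ ε > (0 : ℝ), ε * (α + β + D) = M :=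
      ⟨M / (α + β + D), by positivity, div_mul_cancel₀ _ (by positivity)⟩
    have hM1 : M ≤ d i := min_le_left _ _
    have hM2 : M ≤ d j := (min_le_right _ _).trans (min_le_left _ _)
    have hM3 : M ≤ 1 - d l := (min_le_right _ _).trans (min_le_right _ _)
    have q1 := mul_pos hε p2
    have q2 := mul_pos hε p1
    have q3 := mul_pos hε p3
    rw [mul_add, mul_add] at hεM
    set g : Fin n → ℝ := Pi.single l (ε * D) - Pi.single i (ε * α) - Pi.single j (ε * β) with hg
    have hsumg : ∑ x, g x = ε * D - ε * α - ε * β := by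
      simp [hg, Finset.sum_sub_distrib]
    have hzg : ∑ x, g x • P.side x = 0 := by
      simp only [hg, Pi.sub_apply, sub_smul, Finset.sum_sub_distrib, Pi.single_apply, ite_smul,
        zero_smul, Finset.sum_ite_eq', Finset.mem_univ, if_true, mul_smul, hcr]
      module
    have hmem : d + g ∈ S := by
      refine ⟨fun x _ => ?_, ?_⟩
      · have h1 := hd x
        have hdi := hd i
        have hdj := hd j
        have hdl := hd l
        simp only [hg, Pi.add_apply, Pi.sub_apply, Pi.single_apply]
        by_cases x1 : x = l
        · subst x1
          simp only [if_true, hil.ne', hlj.ne, if_false]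
          constructor <;> linarith [h1.1]
        by_cases x2 : x = i
        · subst x2
          simp only [if_true, hil.ne, (hil.trans hlj).ne, if_false]
          constructor <;> linarith [h1.2]
        by_cases x3 : x = j
        · subst x3
          simp only [if_true, hlj.ne', (hil.trans hlj).ne', if_false]
          constructor <;> linarith [h1.2]
        simpa [x1, x2, x3] using h1
      · rw [Set.mem_preimage, Set.mem_singleton_iff, ← (show P.zpt d = P.zpt c from hdz)]
        simp only [zpt, Pi.add_apply, add_smul, Finset.sum_add_distrib, hzg, add_zero]
    have := hmin hmem
    simp only [Pi.add_apply, Finset.sum_add_distrib, hsumg, Set.mem_ofPred_eq] at this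
    nlinarith
  rcases Finset.eq_empty_or_nonempty (Finset.univ.filter fun l => 0 < d l) with hemp | hne
  · have h0 : ∀ l, d l = 0 := fun l => by
      refine le_antisymm ?_ (hd l).1
      by_contra! h
      have : l ∈ Finset.univ.filter fun l => 0 < d l := by simpa using h
      simp [hemp] at this
    refine ⟨⟨0, by omega⟩, ⟨1, by omega⟩, by simp, d, ⟨hd, fun l h1 h2 => ?_, fun l _ => h0 l⟩, hdz⟩
    simp only [Fin.lt_def] at h1 h2
    omega
  · obtain ⟨i, hi, hi'⟩ := Finset.exists_minimal hne
    obtain ⟨j, hj, hj'⟩ := Finset.exists_maximal hne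
    simp only [Finset.mem_filter, Finset.mem_univ, true_and] at hi hi' hj hj'
    have hlo : ∀ l, l < i → d l = 0 := fun l hl => by
      refine le_antisymm ?_ (hd l).1
      by_contra! h
      exact absurd (hi' h hl.le) (by order)
    have hhi : ∀ l, j < l → d l = 0 := fun l hl => by
      refine le_antisymm ?_ (hd l).1
      by_contra! h
      exact absurd (hj' h hl.le) (by order)
    rcases lt_trichotomy i j with hij | rfl | hij
    · exact ⟨i, j, hij, d, ⟨hd, fun l h1 h2 => htriple i l j h1 h2 hi hj,
        fun l hl => hl.elim (hlo l) (hhi l)⟩, hdz⟩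
    -- A single positive coefficient is paired with the next label, or with the previous one if it
    -- is the last.
    · rcases Nat.lt_or_ge (i.val + 1) n with h | h
      · refine ⟨i, ⟨i + 1, h⟩, by simp [Fin.lt_def], d, ⟨hd, fun l h1 h2 => ?_, fun l hl => ?_⟩, hdz⟩
        · simp only [Fin.lt_def] at h1 h2; omega
        · refine hl.elim (hlo l) fun hl => hhi l ?_
          simp only [Fin.lt_def] at hl ⊢; omega
      · have hi1 := i.isLt
        refine ⟨⟨i - 1, by omega⟩, i, by simp only [Fin.lt_def]; omega, d,
          ⟨hd, fun l h1 h2 => ?_, fun l hl => ?_⟩, hdz⟩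
        · simp only [Fin.lt_def] at h1 h2; omega
        · refine hl.elim (fun hl => hlo l ?_) (hhi l)
          simp only [Fin.lt_def] at hl ⊢; omega
    · exact absurd (hi' hj hij.le) (by order)

end ElnitskyDrawing

/-! ### Boundary coefficients and the polygon as a zonotope. -/

/-- An order-convex set containing the first label is an initial segment; `k` is its least strict
upper bound. It is applied to the signs of a linear functional on the side vectors. -/
theorem exists_iff_lt_of_ordConnected {n : ℕ} (hn : 0 < n) {p : Fin n → Prop}
    (hp : ∀ i l j, i < l → l < j → p i → p j → p l) (h0 : p ⟨0, hn⟩) :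
    ∃ k ≤ n, ∀ l : Fin n, p l ↔ l.val < k := by
  classical
  have hex : ∃ k, ∀ l : Fin n, p l → l.val < k := ⟨n, fun l _ => l.isLt⟩
  refine ⟨Nat.find hex, Nat.find_min' hex fun l _ => l.isLt, fun l =>
    ⟨Nat.find_spec hex l, fun hl => ?_⟩⟩
  have := Nat.find_min hex hl
  push Not at this
  obtain ⟨m, hm, hlm⟩ := this
  rcases hlm.eq_or_lt with h | h
  · rwa [Fin.ext h]
  rcases Nat.eq_zero_or_pos l.val with h' | h'
  · rwa [show l = ⟨0, hn⟩ from Fin.ext h']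
  exact hp _ l m h' h h0 hm

/-- The coefficients of the points of the leftside boundary. -/
def leftCoeff {n : ℕ} (k : Fin n) (a : ℝ) (l : Fin n) : ℝ :=
  if l < k then 1 else if l = k then a else 0

/-- The coefficients of the points of the rightside boundary. -/
def rightCoeff {n : ℕ} (k : Fin n) (a : ℝ) (l : Fin n) : ℝ :=
  if k < l then 1 else if l = k then a else 0

/-- Placing boundary points in faces lets `eq_of_zpt_eq` identify their coefficients. -/
theorem exists_leftCoeff_mem {n : ℕ} (hn : 2 < n) (k : Fin n) {a : ℝ}
    (ha : a ∈ Set.Icc (0 : ℝ) 1) : ∃ i j, i < j ∧ leftCoeff k a ∈ cubeFace i j := by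
  have hmem : ∀ l, leftCoeff k a l ∈ Set.Icc (0 : ℝ) 1 := fun l => by
    unfold leftCoeff; split_ifs <;> first | assumption | simp
  rcases Nat.eq_zero_or_pos k.val with h | h
  · refine ⟨⟨0, by omega⟩, ⟨1, by omega⟩, by simp, hmem, fun l h1 h2 => ?_, fun l hl => ?_⟩
    · simp only [Fin.lt_def] at h1 h2; omega
    · have h1 : ¬ l < k := by simp only [Fin.lt_def] at hl ⊢; omega
      have h2 : l ≠ k := by simp only [Fin.lt_def, ne_eq, Fin.ext_iff] at hl ⊢; omega
      simp [leftCoeff, h1, h2]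
  · refine ⟨⟨0, by omega⟩, k, h, hmem, fun l h1 h2 => by simp [leftCoeff, h2], fun l hl => ?_⟩
    have h1 : k < l := by simp only [Fin.lt_def] at hl ⊢; omega
    simp [leftCoeff, h1.not_gt, h1.ne']

theorem exists_rightCoeff_mem {n : ℕ} (hn : 2 < n) (k : Fin n) {a : ℝ}
    (ha : a ∈ Set.Icc (0 : ℝ) 1) : ∃ i j, i < j ∧ rightCoeff k a ∈ cubeFace i j := by
  have hmem : ∀ l, rightCoeff k a l ∈ Set.Icc (0 : ℝ) 1 := fun l => by
    unfold rightCoeff; split_ifs <;> first | assumption | simp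
  rcases Nat.lt_or_ge (k.val + 1) n with h | h
  · refine ⟨k, ⟨n - 1, by omega⟩, by simp only [Fin.lt_def]; omega, hmem,
      fun l h1 h2 => by simp [rightCoeff, h1], fun l hl => ?_⟩
    have h1 : l < k := by
      have := l.isLt
      simp only [Fin.lt_def] at hl ⊢; omega
    simp [rightCoeff, h1.not_gt, h1.ne]
  · refine ⟨⟨n - 2, by omega⟩, ⟨n - 1, by omega⟩, by simp only [Fin.lt_def]; omega, hmem,
      fun l h1 h2 => ?_, fun l hl => ?_⟩
    · simp only [Fin.lt_def] at h1 h2; omega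
    · have := l.isLt
      have h1 : ¬ k < l := by simp only [Fin.lt_def] at hl ⊢; omega
      have h2 : l ≠ k := by simp only [Fin.lt_def, ne_eq, Fin.ext_iff] at hl ⊢; omega
      simp [rightCoeff, h1, h2]

theorem segment_add_eq_image (p v : Plane) :
    segment ℝ p (p + v) = (fun x : ℝ => p + x • v) '' Set.Icc 0 1 := by
  simp [segment_eq_image']

namespace ElnitskyDrawing

variable {n : ℕ} (P : ElnitskyDrawing n)

theorem zpt_leftCoeff (k : Fin n) (a : ℝ) :
    P.zpt (leftCoeff k a) = P.leftVertex k + a • P.side k := by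
  have : ∀ l, leftCoeff k a l • P.side l =
      (if l.val < k.val then P.side l else 0) + (if l = k then a • P.side k else 0) := by
    intro l
    rcases lt_trichotomy l k with h | rfl | h
    · simp [leftCoeff, h, h.ne, Fin.lt_def.1 h]
    · simp [leftCoeff]
    · simp [leftCoeff, h.not_gt, h.ne']
  simp [zpt, leftVertex, this, Finset.sum_add_distrib, Finset.sum_filter, add_assoc]

theorem rightVertex_eq (k : ℕ) : P.rightVertex (longestElement n) k =
    P.top + ∑ l : Fin n with l.rev.val < k, P.side l := by
  rw [rightVertex, Finset.sum_filter, Finset.sum_filter, ← Equiv.sum_comp Fin.revPerm]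
  simp [longestElement]

theorem zpt_rightCoeff (k : Fin n) (a : ℝ) :
    P.zpt (rightCoeff k a) = P.rightVertex (longestElement n) k.rev + a • P.side k := by
  have : ∀ l, rightCoeff k a l • P.side l =
      (if l.rev.val < k.rev.val then P.side l else 0) + (if l = k then a • P.side k else 0) := by
    intro l
    have hiff : l.rev.val < k.rev.val ↔ k < l := by rw [← Fin.lt_def, Fin.rev_lt_rev]
    simp only [hiff]
    rcases lt_trichotomy k l with h | rfl | h
    · simp [rightCoeff, h, h.ne']
    · simp [rightCoeff]
    · simp [rightCoeff, h.not_gt, h.ne]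
  simp [zpt, rightVertex_eq, this, Finset.sum_add_distrib, Finset.sum_filter, add_assoc]

theorem mem_longestBoundary_iff {x : Plane} : x ∈ P.longestBoundary ↔ ∃ k : Fin n,
    ∃ a ∈ Set.Icc (0 : ℝ) 1, P.zpt (leftCoeff k a) = x ∨ P.zpt (rightCoeff k a) = x := by
  simp only [zpt_leftCoeff, zpt_rightCoeff, longestBoundary, boundary, Set.mem_union,
    Set.mem_iUnion]
  have hl : ∀ k : Fin n, P.leftVertex (k + 1) = P.leftVertex k + P.side k :=
    fun k => P.leftVertex_succ k.isLt
  have hr : ∀ k : Fin n, P.rightVertex (longestElement n) (k + 1) =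
      P.rightVertex (longestElement n) k + P.side k.rev :=
    fun k => P.rightVertex_succ _ k.isLt
  simp only [hl, hr, segment_add_eq_image]
  constructor
  · rintro (⟨k, a, ha, h⟩ | ⟨k, a, ha, h⟩)
    · exact ⟨k, a, ha, Or.inl h⟩
    · exact ⟨k.rev, a, ha, Or.inr (by rwa [Fin.rev_rev])⟩
  · rintro ⟨k, a, ha, h | h⟩
    · exact Or.inl ⟨k, a, ha, h⟩
    · exact Or.inr ⟨k.rev, a, ha, by rwa [Fin.rev_rev]⟩

/-- The coefficients of a boundary point decrease or increase from `1` to `0` with at most one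
fractional value in between. -/
theorem coeff_of_mem_longestBoundary (hn : 2 < n) {i j : Fin n} (hij : i < j) {c : Fin n → ℝ}
    (hc : c ∈ cubeFace i j) (h : P.zpt c ∈ P.longestBoundary) :
    (∀ l m, l < m → c m ≠ 0 → c l = 1) ∨ (∀ l m, l < m → c l ≠ 0 → c m = 1) := by
  obtain ⟨k, a, ha, h | h⟩ := P.mem_longestBoundary_iff.1 h
  · obtain ⟨i', j', hij', hmem⟩ := exists_leftCoeff_mem hn k ha
    left
    intro l m hlm hm
    rw [← P.eq_of_zpt_eq hij' hij hmem hc h] at hm ⊢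
    have : m ≤ k := by
      by_contra! hkm
      simp [leftCoeff, hkm.not_gt, hkm.ne'] at hm
    simp [leftCoeff, hlm.trans_le this]
  · obtain ⟨i', j', hij', hmem⟩ := exists_rightCoeff_mem hn k ha
    right
    intro l m hlm hm
    rw [← P.eq_of_zpt_eq hij' hij hmem hc h] at hm ⊢
    have : k ≤ l := by
      by_contra! hkm
      simp [rightCoeff, hkm.not_gt, hkm.ne] at hm
    simp [rightCoeff, this.trans_lt hlm]

/-- The polygon is the zonotope of its side vectors. -/
theorem longestRegion_eq (hn : 2 < n) :
    P.longestRegion = P.zpt '' {c | ∀ l, c l ∈ Set.Icc (0 : ℝ) 1} := by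
  apply Set.Subset.antisymm
  · apply convexHull_min
    · intro x hx
      obtain ⟨k, a, ha, h | h⟩ := P.mem_longestBoundary_iff.1 hx
      · obtain ⟨i, j, -, hmem⟩ := exists_leftCoeff_mem hn k ha
        exact ⟨_, hmem.1, h⟩
      · obtain ⟨i, j, -, hmem⟩ := exists_rightCoeff_mem hn k ha
        exact ⟨_, hmem.1, h⟩
    · rintro _ ⟨c, hc, rfl⟩ _ ⟨d, hd, rfl⟩ a b ha hb hab
      exact ⟨a • c + b • d, fun l => convex_Icc (0 : ℝ) 1 (hc l) (hd l) ha hb hab,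
        P.zpt_combo hab⟩
  · rintro _ ⟨c, hc, rfl⟩
    set V : Set Plane := (fun k => P.leftVertex k) '' Set.Iic n ∪
      (fun k => P.rightVertex (longestElement n) k) '' Set.Iic n with hV
    have hVfin : V.Finite := ((Set.finite_Iic n).image _).union ((Set.finite_Iic n).image _)
    have hVsub : V ⊆ P.longestBoundary := by
      rintro _ (⟨k, hk, rfl⟩ | ⟨k, hk, rfl⟩)
      · refine Or.inl (Set.mem_iUnion.2 ?_)
        rcases Nat.eq_zero_or_pos k with rfl | h
        · exact ⟨⟨0, by omega⟩, left_mem_segment _ _ _⟩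
        · refine ⟨⟨k - 1, by have := Set.mem_Iic.1 hk; omega⟩, ?_⟩
          simp only [Nat.sub_add_cancel h]
          exact right_mem_segment _ _ _
      · refine Or.inr (Set.mem_iUnion.2 ?_)
        rcases Nat.eq_zero_or_pos k with rfl | h
        · exact ⟨⟨0, by omega⟩, left_mem_segment _ _ _⟩
        · refine ⟨⟨k - 1, by have := Set.mem_Iic.1 hk; omega⟩, ?_⟩
          simp only [Nat.sub_add_cancel h]
          exact right_mem_segment _ _ _
    by_contra hx
    have hx' : P.zpt c ∉ convexHull ℝ V := fun h => hx (convexHull_mono hVsub h)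
    -- A point outside the hull of the vertices would be separated from it by `f`. But `f` is
    -- largest on the zonotope when exactly the sides with positive value are taken, and these
    -- labels form an initial or a final segment, so a vertex attains the maximum.
    obtain ⟨f, u, hfu, hux⟩ := geometric_hahn_banach_closed_point (convex_convexHull ℝ V)
      (hVfin.isClosed_convexHull ℝ) hx'
    have hcomb : ∀ i l j, i < l → l < j → ∃ α > (0 : ℝ), ∃ β > (0 : ℝ), ∃ D > (0 : ℝ),
        D * f (P.side l) = α * f (P.side i) + β * f (P.side j) := by
      intro i l j h1 h2
      refine ⟨_, P.convex l j h2, _, P.convex i l h1, _, P.convex i j (h1.trans h2), ?_⟩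
      have := congrArg f (cross_smul_eq (P.side i) (P.side j) (P.side l))
      simpa using this
    have hle : f (P.zpt c) ≤ f P.top + ∑ l, if 0 < f (P.side l) then f (P.side l) else 0 := by
      simp only [zpt, map_add, map_sum, map_smul, smul_eq_mul]
      gcongr with l
      split_ifs with h
      · exact mul_le_of_le_one_left h.le (hc l).2
      · exact mul_nonpos_of_nonneg_of_nonpos (hc l).1 (not_lt.1 h)
    have hsel : ∃ y ∈ V, f y = f P.top + ∑ l, if 0 < f (P.side l) then f (P.side l) else 0 := by
      by_cases h0 : 0 < f (P.side ⟨0, by omega⟩)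
      · obtain ⟨k, hk, hkl⟩ := exists_iff_lt_of_ordConnected (by omega)
          (p := fun l => 0 < f (P.side l)) (fun i l j h1 h2 hi hj => by
            obtain ⟨α, hα, β, hβ, D, hD, h⟩ := hcomb i l j h1 h2
            have : 0 < D * f (P.side l) := by rw [h]; positivity
            exact (mul_pos_iff_of_pos_left hD).1 this) h0
        refine ⟨P.leftVertex k, Or.inl ⟨k, hk, rfl⟩, ?_⟩
        simp only [hkl, leftVertex, map_add, map_sum, ← Finset.sum_filter]
      · obtain ⟨k, hk, hkl⟩ := exists_iff_lt_of_ordConnected (by omega)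
          (p := fun l => ¬ 0 < f (P.side l)) (fun i l j h1 h2 hi hj => by
            obtain ⟨α, hα, β, hβ, D, hD, h⟩ := hcomb i l j h1 h2
            intro hl
            have := mul_pos hD hl
            rw [h] at this
            have := mul_nonneg hα.le (neg_nonneg.2 (not_lt.1 hi))
            have := mul_nonneg hβ.le (neg_nonneg.2 (not_lt.1 hj))
            linarith) h0
        refine ⟨_, Or.inr ⟨n - k, Nat.sub_le _ _, rfl⟩, ?_⟩
        have hiff : ∀ l : Fin n, 0 < f (P.side l) ↔ l.rev.val < n - k := by
          intro l
          have h1 := hkl l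
          have h2 := l.isLt
          rw [Fin.val_rev, ← not_iff_not, h1]
          omega
        simp only [hiff, rightVertex_eq, map_add, map_sum, ← Finset.sum_filter]
    obtain ⟨y, hy, hfy⟩ := hsel
    have := hfu y (subset_convexHull _ _ hy)
    linarith

/-! ### The standard tiling and its perimeter tiles. -/

/-- The tile with labels `i < j` of the standard tiling. -/
noncomputable def stdTile (i j : Fin n) (h : i < j) : RhombusTile n :=
  ⟨P.top + ∑ l : Fin n with i < l ∧ l < j, P.side l, i, j, h⟩

theorem zpt_facePoint {i j : Fin n} (h : i < j) (a b : ℝ) : P.zpt (facePoint i j a b) =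
    (P.stdTile i j h).vertex + a • P.side i + b • P.side j := by
  have : ∀ l, facePoint i j a b l • P.side l = (if i < l ∧ l < j then P.side l else 0) +
      (if l = i then a • P.side i else 0) + (if l = j then b • P.side j else 0) := by
    intro l
    by_cases h1 : l = i
    · subst h1; simp [facePoint, h.ne]
    by_cases h2 : l = j
    · subst h2; simp [facePoint, h1]
    by_cases h3 : i < l ∧ l < j <;> simp [facePoint, h1, h2, h3]
  simp [zpt, stdTile, this, Finset.sum_add_distrib, Finset.sum_filter, add_assoc]

theorem carrier_stdTile {i j : Fin n} (h : i < j) :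
    P.carrier (P.stdTile i j h) = P.zpt '' cubeFace i j := by
  ext x
  constructor
  · rintro ⟨a, ha, b, hb, rfl⟩
    exact ⟨_, facePoint_mem h ha hb, P.zpt_facePoint h a b⟩
  · rintro ⟨c, hc, rfl⟩
    refine ⟨c i, hc.1 i, c j, hc.1 j, ?_⟩
    rw [eq_facePoint_of_mem hc, P.zpt_facePoint h, facePoint_left, facePoint_right h]
    rfl

theorem edge_stdTile_zero {i j : Fin n} (h : i < j) : P.edge (P.stdTile i j h) 0 =
    (fun x => P.zpt (facePoint i j x 0)) '' Set.Icc 0 1 := by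
  simp only [P.zpt_facePoint h, zero_smul, add_zero]
  exact segment_add_eq_image _ _

theorem edge_stdTile_one {i j : Fin n} (h : i < j) : P.edge (P.stdTile i j h) 1 =
    (fun x => P.zpt (facePoint i j 1 x)) '' Set.Icc 0 1 := by
  simp only [P.zpt_facePoint h, one_smul]
  exact segment_add_eq_image _ _

theorem edge_stdTile_two {i j : Fin n} (h : i < j) : P.edge (P.stdTile i j h) 2 =
    (fun x => P.zpt (facePoint i j x 1)) '' Set.Icc 0 1 := by
  simp only [P.zpt_facePoint h, one_smul, add_right_comm]
  rw [← segment_add_eq_image, segment_symm, add_right_comm]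
  rfl

theorem edge_stdTile_three {i j : Fin n} (h : i < j) : P.edge (P.stdTile i j h) 3 =
    (fun x => P.zpt (facePoint i j 0 x)) '' Set.Icc 0 1 := by
  simp only [P.zpt_facePoint h, zero_smul, add_zero]
  rw [← segment_add_eq_image, segment_symm]
  rfl

/-- Along an edge a single coefficient varies; this form treats the four edges uniformly. -/
theorem exists_edge_stdTile {i j : Fin n} (h : i < j) (k : Fin 4) : ∃ m c,
    (∀ x ∈ Set.Icc (0 : ℝ) 1, Function.update c m x ∈ cubeFace i j) ∧
      P.edge (P.stdTile i j h) k = (fun x => P.zpt (Function.update c m x)) '' Set.Icc 0 1 := by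
  have h0 : (0 : ℝ) ∈ Set.Icc (0 : ℝ) 1 := by simp
  have h1 : (1 : ℝ) ∈ Set.Icc (0 : ℝ) 1 := by simp
  have hk : k = 0 ∨ k = 1 ∨ k = 2 ∨ k = 3 := by omega
  rcases hk with rfl | rfl | rfl | rfl
  · refine ⟨i, facePoint i j 0 0, ?_⟩
    simp only [facePoint_update_left, edge_stdTile_zero]
    exact ⟨fun x hx => facePoint_mem h hx h0, trivial⟩
  · refine ⟨j, facePoint i j 1 0, ?_⟩
    simp only [facePoint_update_right h, edge_stdTile_one]
    exact ⟨fun x hx => facePoint_mem h h1 hx, trivial⟩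
  · refine ⟨i, facePoint i j 0 1, ?_⟩
    simp only [facePoint_update_left, edge_stdTile_two]
    exact ⟨fun x hx => facePoint_mem h hx h1, trivial⟩
  · refine ⟨j, facePoint i j 0 0, ?_⟩
    simp only [facePoint_update_right h, edge_stdTile_three]
    exact ⟨fun x hx => facePoint_mem h h0 hx, trivial⟩

open Classical in
/-- The standard tiling. -/
noncomputable def stdTiling : Finset (RhombusTile n) :=
  Finset.univ.image fun p : {p : Fin n × Fin n // p.1 < p.2} => P.stdTile p.1.1 p.1.2 p.2

theorem mem_stdTiling {t : RhombusTile n} :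
    t ∈ P.stdTiling ↔ ∃ i j, ∃ h : i < j, P.stdTile i j h = t := by
  simp [stdTiling]

/-- Covering is the existence of a face point in each fibre; disjointness and matching of edges come
from its uniqueness. -/
theorem isRhombicTiling_stdTiling (hn : 2 < n) : P.IsRhombicTiling P.stdTiling where
  cover := by
    rw [P.longestRegion_eq hn]
    ext x
    simp only [Set.mem_iUnion, mem_stdTiling]
    constructor
    · rintro ⟨_, ⟨i, j, h, rfl⟩, hx⟩
      rw [carrier_stdTile] at hx
      obtain ⟨c, hc, rfl⟩ := hx
      exact ⟨c, hc.1, rfl⟩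
    · rintro ⟨c, hc, rfl⟩
      obtain ⟨i, j, h, c', hc', hz⟩ := P.exists_mem_cubeFace hn hc
      exact ⟨_, ⟨i, j, h, rfl⟩, by rw [carrier_stdTile]; exact ⟨c', hc', hz⟩⟩
  disjoint := by
    intro s hs t ht hst
    obtain ⟨i, j, h, rfl⟩ := P.mem_stdTiling.1 hs
    obtain ⟨i', j', h', rfl⟩ := P.mem_stdTiling.1 ht
    rw [Set.disjoint_left]
    intro x hx hx'
    apply hst
    obtain ⟨a, ha, b, hb, e⟩ := exists_of_mem_interior_parallelogram (P.convex i j h).ne' hx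
    obtain ⟨a', ha', b', hb', e'⟩ :=
      exists_of_mem_interior_parallelogram (P.convex i' j' h').ne' hx'
    rw [← zpt_facePoint] at e e'
    have m := facePoint_mem h (Set.Ioo_subset_Icc_self ha) (Set.Ioo_subset_Icc_self hb)
    have m' := facePoint_mem h' (Set.Ioo_subset_Icc_self ha') (Set.Ioo_subset_Icc_self hb')
    have heq := P.eq_of_zpt_eq h h' m m' (e.symm.trans e')
    -- A fractional coefficient can occur only at the two labels of a tile, so a common interior
    -- point determines both labels.
    have frac : ∀ l, (facePoint i' j' a' b' l) ∈ Set.Ioo (0 : ℝ) 1 → l = i' ∨ l = j' := by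
      intro l hl
      by_contra! hcon
      rw [facePoint, if_neg hcon.1, if_neg hcon.2] at hl
      split_ifs at hl <;> simp at hl
    have hi := frac i (by rw [← heq, facePoint_left]; exact ha)
    have hj := frac j (by rw [← heq, facePoint_right h]; exact hb)
    have : i = i' ∧ j = j' := by
      rcases hi with rfl | rfl <;> rcases hj with rfl | rfl
      · exact absurd h (lt_irrefl _)
      · exact ⟨rfl, rfl⟩
      · exact absurd h h'.not_gt
      · exact absurd h (lt_irrefl _)
    obtain ⟨rfl, rfl⟩ := this
    rfl
  discrete := by
    intro s hs t ht k l hne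
    obtain ⟨i, j, h, rfl⟩ := P.mem_stdTiling.1 hs
    obtain ⟨i', j', h', rfl⟩ := P.mem_stdTiling.1 ht
    obtain ⟨m, c, hc, e⟩ := P.exists_edge_stdTile h k
    obtain ⟨m', c', hc', e'⟩ := P.exists_edge_stdTile h' l
    rw [e, e'] at hne ⊢
    obtain ⟨x, ⟨⟨a, ha, hxa⟩, ⟨a', ha', hxa'⟩⟩, y, ⟨⟨b, hb, hyb⟩, ⟨b', hb', hyb'⟩⟩, hxy⟩ := hne
    have hx := P.eq_of_zpt_eq h h' (hc a ha) (hc' a' ha') (hxa.trans hxa'.symm)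
    have hy := P.eq_of_zpt_eq h h' (hc b hb) (hc' b' hb') (hyb.trans hyb'.symm)
    have hab : a ≠ b := by
      rintro rfl
      exact hxy (hxa.symm.trans hyb)
    -- Two common points of the edges differ at the one varying label of either edge, so these
    -- labels agree.
    have hm : m = m' := by
      by_contra hmm
      have h1 := congrFun hx m
      have h2 := congrFun hy m
      simp only [Function.update_self, Function.update_of_ne hmm] at h1 h2
      exact hab (h1.trans h2.symm)
    subst hm
    have : ∀ z, Function.update c m z = Function.update c' m z := by
      intro z
      rw [← Function.update_idem a z c, hx, Function.update_idem]
    simp only [this]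

/-- The coefficients of an edge midpoint must be monotone in the label if the edge is on the
boundary. Edge `0` then forces the first two labels, edge `3` the last two, and edges `1` and `2`
together the first and last. -/
theorem perim_stdTiling_le (hn : 2 < n) : P.perim P.stdTiling ≤ 3 := by
  classical
  have half : (1 / 2 : ℝ) ∈ Set.Icc (0 : ℝ) 1 := by constructor <;> norm_num
  have h0 : (0 : ℝ) ∈ Set.Icc (0 : ℝ) 1 := by simp
  have h1 : (1 : ℝ) ∈ Set.Icc (0 : ℝ) 1 := by simp
  have hsub : P.stdTiling.filter (fun t => P.IsPerimeterTile t) ⊆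
      {P.stdTile ⟨0, by omega⟩ ⟨1, by omega⟩ (by simp),
        P.stdTile ⟨n - 2, by omega⟩ ⟨n - 1, by omega⟩ (by simp only [Fin.lt_def]; omega),
        P.stdTile ⟨0, by omega⟩ ⟨n - 1, by omega⟩ (by simp only [Fin.lt_def]; omega)} := by
    intro t ht
    obtain ⟨ht, hper⟩ := Finset.mem_filter.1 ht
    obtain ⟨i, j, h, rfl⟩ := P.mem_stdTiling.1 ht
    have hlt := Fin.lt_def.1 h
    have hjn := j.isLt
    have left_eq : ∀ {a b : ℝ}, a ∈ Set.Icc (0 : ℝ) 1 → b ∈ Set.Icc (0 : ℝ) 1 →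
        (∀ l m, l < m → facePoint i j a b m ≠ 0 → facePoint i j a b l = 1) →
        b ≠ 0 ∨ a ≠ 0 → i.val = 0 := by
      intro a b ha hb hmono hab
      by_contra hi
      have hz : (⟨0, by omega⟩ : Fin n) < i := by simp only [Fin.lt_def]; omega
      have h3 := (facePoint_mem h ha hb).2.2 _ (Or.inl hz)
      rcases hab with hb | ha
      · have := hmono _ j (hz.trans h) (by rwa [facePoint_right h])
        linarith
      · have := hmono _ i hz (by rwa [facePoint_left])
        linarith
    have right_eq : ∀ {a b : ℝ}, a ∈ Set.Icc (0 : ℝ) 1 → b ∈ Set.Icc (0 : ℝ) 1 →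
        (∀ l m, l < m → facePoint i j a b l ≠ 0 → facePoint i j a b m = 1) →
        b ≠ 0 → j.val = n - 1 := by
      intro a b ha hb hmono hb'
      by_contra hi
      have hz : j < (⟨n - 1, by omega⟩ : Fin n) := by simp only [Fin.lt_def]; omega
      have h3 := (facePoint_mem h ha hb).2.2 _ (Or.inr hz)
      have := hmono j _ hz (by rwa [facePoint_right h])
      linarith
    have between : ∀ {a b : ℝ}, a ∈ Set.Icc (0 : ℝ) 1 → b ∈ Set.Icc (0 : ℝ) 1 →
        (∀ l, i < l → l < j → facePoint i j a b l ≠ 1) → j.val = i.val + 1 := by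
      intro a b ha hb hno
      by_contra hi
      exact hno ⟨i + 1, by omega⟩ (by simp [Fin.lt_def]) (by simp only [Fin.lt_def]; omega)
        ((facePoint_mem h ha hb).2.1 _ (by simp [Fin.lt_def]) (by simp only [Fin.lt_def]; omega))
    have e0 : P.edge (P.stdTile i j h) 0 ⊆ P.longestBoundary → i.val = 0 ∧ j.val = 1 := by
      intro hs
      rw [edge_stdTile_zero] at hs
      rcases P.coeff_of_mem_longestBoundary hn h (facePoint_mem h half h0)
        (hs ⟨1 / 2, half, rfl⟩) with hm | hm
      · have hi := left_eq half h0 hm (Or.inr (by norm_num))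
        have := between half h0 fun l hl _ hl1 => by
          have := hm i l hl (by rw [hl1]; norm_num)
          rw [facePoint_left] at this
          norm_num at this
        omega
      · have := hm i j h (by rw [facePoint_left]; norm_num)
        rw [facePoint_right h] at this
        norm_num at this
    have e1 : P.edge (P.stdTile i j h) 1 ⊆ P.longestBoundary → i.val = 0 := by
      intro hs
      rw [edge_stdTile_one] at hs
      rcases P.coeff_of_mem_longestBoundary hn h (facePoint_mem h h1 half)
        (hs ⟨1 / 2, half, rfl⟩) with hm | hm
      · exact left_eq h1 half hm (Or.inl (by norm_num))
      · have := hm i j h (by rw [facePoint_left]; norm_num)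
        rw [facePoint_right h] at this
        norm_num at this
    have e2 : P.edge (P.stdTile i j h) 2 ⊆ P.longestBoundary → j.val = n - 1 := by
      intro hs
      rw [edge_stdTile_two] at hs
      rcases P.coeff_of_mem_longestBoundary hn h (facePoint_mem h half h1)
        (hs ⟨1 / 2, half, rfl⟩) with hm | hm
      · have := hm i j h (by rw [facePoint_right h]; norm_num)
        rw [facePoint_left] at this
        norm_num at this
      · exact right_eq half h1 hm (by norm_num)
    have e3 : P.edge (P.stdTile i j h) 3 ⊆ P.longestBoundary →
        i.val = n - 2 ∧ j.val = n - 1 := by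
      intro hs
      rw [edge_stdTile_three] at hs
      rcases P.coeff_of_mem_longestBoundary hn h (facePoint_mem h h0 half)
        (hs ⟨1 / 2, half, rfl⟩) with hm | hm
      · have := hm i j h (by rw [facePoint_right h]; norm_num)
        rw [facePoint_left] at this
        norm_num at this
      · have hj := right_eq h0 half hm (by norm_num)
        have := between h0 half fun l _ hl hl1 => by
          have := hm l j hl (by rw [hl1]; norm_num)
          rw [facePoint_right h] at this
          norm_num at this
        omega
    have hcases : (i.val = 0 ∧ j.val = 1) ∨ (i.val = n - 2 ∧ j.val = n - 1) ∨
        (i.val = 0 ∧ j.val = n - 1) := by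
      obtain ⟨k, hk, hk'⟩ := hper
      have hk4 : k = 0 ∨ k = 1 ∨ k = 2 ∨ k = 3 := by omega
      rcases hk4 with rfl | rfl | rfl | rfl
      · exact Or.inl (e0 hk)
      · exact Or.inr (Or.inr ⟨e1 hk, e2 hk'⟩)
      · exact Or.inr (Or.inl (e3 hk'))
      · exact Or.inl (e0 hk')
    have heq : ∀ i' j' : Fin n, ∀ h' : i' < j', i = i' → j = j' →
        P.stdTile i j h = P.stdTile i' j' h' := by
      rintro _ _ _ rfl rfl; rfl
    simp only [Finset.mem_insert, Finset.mem_singleton]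
    rcases hcases with ⟨a, b⟩ | ⟨a, b⟩ | ⟨a, b⟩
    · exact Or.inl (heq _ _ _ (Fin.ext a) (Fin.ext b))
    · exact Or.inr (Or.inl (heq _ _ _ (Fin.ext a) (Fin.ext b)))
    · exact Or.inr (Or.inr (heq _ _ _ (Fin.ext a) (Fin.ext b)))
  rw [perim]
  exact (Finset.card_le_card (by convert hsub)).trans Finset.card_le_three

end ElnitskyDrawing

theorem mainTheorem1 (n : ℕ) (hn : 2 < n) (P : ElnitskyDrawing n) :
    IsLeast {m : ℕ | ∃ T : Finset (RhombusTile n), P.IsRhombicTiling T ∧ P.perim T = m} 3 := by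
  have : NeZero n := ⟨by omega⟩
  constructor
  · have hT := P.isRhombicTiling_stdTiling hn
    exact ⟨P.stdTiling, hT, le_antisymm (P.perim_stdTiling_le hn) (hT.three_le_perim hn)⟩
  · rintro m ⟨T, hT, rfl⟩
    exact hT.three_le_perim hn
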